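/- Fix integers $l_1,l_2\ge 1$ and put $n=l_1l_2$. Circuits are sequences of layers. A layer is a set of one-qubit and two-qubit unitary gates (arbitrary unitaries) that act on pairwise disjoint sets of qubits, and the depth of a circuit is its number of layers. A circuit is constrained to a graph $G$ on its qubits if each of its two-qubit gates acts on two qubits that are adjacent in $G$. Let $G_v$ be the graph on $n+1$ qubits that consists of the $l_1\times l_2$ lattice (the grid graph on $n$ qubits) and one further qubit, the control qubit, joined only to one lattice site $v$. There is a universal constant $K$ such that the following holds for all $l_1,l_2\ge 1$, all $d\ge 0$, all lattice sites $v$, and every circuit $\mathcal C$ of depth $d$ on the $n$ lattice qubits, whose two-qubit gates may act on arbitrary pairs of qubits. Let $\mathbf U$ be the unitary of $\mathcal C$. 1. There is a circuit on the $n+1$ qubits, constrained to $G_v$ and of depth at most $K\,d\,(l_1+l_2)$, that implements exactly the controlled unitary $|0\rangle\langle 0|\otimes \mathbf I+|1\rangle\langle 1|\otimes \mathbf U$, where the first factor is the control qubit. 2. If $d\ge 1$, then for each $j\in\{0,1\}$ there is a circuit on the $n+1$ qubits, constrained to $G_v$ and of depth at most $K\,d\,(l_1+l_2)$, that implements exactly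 the Hadamard test $$(H\otimes \mathbf I)\,(S^{j}\otimes \mathbf I)\,\bigl(|0\rangle\langle 0|\otimes \mathbf I+|1\rangle\langle 1|\otimes \mathbf U\bigr)\,(H\otimes \mathbf I),\qquad S=\mathrm{diag}(1,i).$$ Applied to $|0^{n+1}\rangle$ and followed by a measurement of the control qubit in the computational basis, it yields the outcome $0$ with probability $\tfrac12\bigl(1+\mathrm{Re}\,\langle 0^n|\mathbf U|0^n\rangle\bigr)$ for $j=0$ and $\tfrac12\bigl(1-\mathrm{Im}\,\langle 0^n|\mathbf U|0^n\rangle\bigr)$ for $j=1$. -/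

import Mathlib

open scoped Matrix

namespace QCircuit

section Basic

variable {Q : Type*} [Fintype Q] [DecidableEq Q]

/-- Computational basis states of a register whose qubits are indexed by `Q`
(`false` is `|0⟩`, `true` is `|1⟩`). -/
abbrev Basis (Q : Type*) : Type _ := Q → Bool

/-- Operators on the `2 ^ |Q|`-dimensional state space, in the computational basis. -/
abbrev Op (Q : Type*) : Type _ := Matrix (Basis Q) (Basis Q) ℂ

/-- The operator `u` applied to the qubit `q`, tensored with the identity on all other qubits. -/
def applyOne (q : Q) (u : Matrix Bool Bool ℂ) : Op Q := fun x y =>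
  if ∀ r, r ≠ q → x r = y r then u (x q) (y q) else 0

/-- The operator `u` applied to the qubits `p`, `q` (in this order), tensored with the identity on
all other qubits. -/
def applyTwo (p q : Q) (u : Matrix (Bool × Bool) (Bool × Bool) ℂ) : Op Q := fun x y =>
  if ∀ r, r ≠ p → r ≠ q → x r = y r then u (x p, x q) (y p, y q) else 0

/-- Gates: arbitrary unitaries on one qubit, or on two distinct qubits. -/
inductive Gate (Q : Type*) where
  | one (q : Q) (u : Matrix.unitaryGroup Bool ℂ) : Gate Q
  | two (p q : Q) (hpq : p ≠ q) (u : Matrix.unitaryGroup (Bool × Bool) ℂ) : Gate Q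

/-- The set of qubits on which a gate operates. -/
def Gate.support {Q : Type*} : Gate Q → Set Q
  | .one q _ => {q}
  | .two p q _ _ => {p, q}

/-- The operator of a gate on the whole register. -/
def Gate.op : Gate Q → Op Q
  | .one q u => applyOne q u
  | .two p q _ u => applyTwo p q u

/-- A gate respects the connectivity graph `G` if it is a one-qubit gate or a two-qubit gate on
two qubits that are adjacent in `G`. -/
def Gate.Under {Q : Type*} (G : SimpleGraph Q) : Gate Q → Prop
  | .one _ _ => True
  | .two p q _ _ => G.Adj p q

/-- A one-layer circuit: finitely many gates that operate on pairwise disjoint sets of qubits. -/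
structure Layer (Q : Type*) where
  gates : List (Gate Q)
  disjoint : gates.Pairwise fun g h => Disjoint g.support h.support

/-- The operator of a layer (its gates commute, so their order is irrelevant). -/
def Layer.op (L : Layer Q) : Op Q := (L.gates.map Gate.op).prod

/-- A circuit is a sequence of layers; the head of the list is performed first. -/
abbrev Circuit (Q : Type*) : Type _ := List (Layer Q)

/-- The depth of a circuit: the number of its layers. -/
def Circuit.depth {Q : Type*} (C : Circuit Q) : ℕ := List.length C

/-- The operator `C⁽ᵈ⁾ ⋯ C⁽²⁾ C⁽¹⁾` implemented by a circuit with layers `C⁽¹⁾, …, C⁽ᵈ⁾`. -/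
def Circuit.op (C : Circuit Q) : Op Q := (List.map Layer.op C).reverse.prod

/-- The circuit is constrained to the connectivity graph `G`. -/
def Circuit.Under {Q : Type*} (G : SimpleGraph Q) (C : Circuit Q) : Prop :=
  ∀ L ∈ C, ∀ g ∈ L.gates, g.Under G

/-! A register `Q` together with one further qubit, the control qubit, has the index type
`Option Q`: the control qubit is `none`, and the qubits of `Q` are `some q`. -/

/-- The controlled operator: the identity on `Q` if the control qubit is `|0⟩`, and `U` on `Q` if
it is `|1⟩`. -/
def controlled (U : Op Q) : Op (Option Q) := fun x y =>
  if x none = y none then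
    if x none = true then U (fun q => x (some q)) (fun q => y (some q))
    else if (fun q => x (some q)) = (fun q => y (some q)) then 1 else 0
  else 0

/-- The Hadamard gate. -/
noncomputable def gateH : Matrix Bool Bool ℂ := fun a b =>
  if a = true ∧ b = true then -((√2 : ℝ) : ℂ)⁻¹ else ((√2 : ℝ) : ℂ)⁻¹

/-- The phase gate `diag (1, i)`. -/
noncomputable def gateS : Matrix Bool Bool ℂ :=
  Matrix.diagonal fun a => if a = true then Complex.I else 1

/-- The operator of the Hadamard test circuit: `H` on the control qubit, then controlled `U`, then
`S ^ j` and `H` on the control qubit. -/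
noncomputable def hadamardTest (U : Op Q) (j : ℕ) : Op (Option Q) :=
  applyOne none gateH * applyOne none (gateS ^ j) * controlled U * applyOne none gateH

/-- The all-zero basis state `|0 ⋯ 0⟩`. -/
def zeroState (Q : Type*) : Basis Q := fun _ => false

/-- The probability of the outcome `0` when `W` is applied to `|0 ⋯ 0⟩` and the control qubit is
then measured in the computational basis. -/
noncomputable def probZero (W : Op (Option Q)) : ℝ :=
  ∑ x : Basis (Option Q), if x none = false then ‖W x (zeroState (Option Q))‖ ^ 2 else 0

end Basic

/-- The `l₁ × l₂` lattice: sites are adjacent when they are at unit distance in one coordinate and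
agree in the other one. -/
def lattice (l₁ l₂ : ℕ) : SimpleGraph (Fin l₁ × Fin l₂) :=
  SimpleGraph.boxProd (SimpleGraph.pathGraph l₁) (SimpleGraph.pathGraph l₂)

/-- The graph `G` with one more vertex, the control qubit, which is joined to the single
vertex `v`. -/
def withControl {Q : Type*} (G : SimpleGraph Q) (v : Q) : SimpleGraph (Option Q) :=
  G.map some ⊔ SimpleGraph.edge none (some v)

end QCircuit

/-!
A diagonal unitary on one or two qubits is, up to a phase, a product of two commutators with
(a permutation of) the Pauli operator `X` on its qubits. Hence every gate has the form
`u • a₀ (X a₁ X) a₂ (X a₃ X) a₄` with `a₀ a₁ a₂ a₃ a₄ = 1` and a phase `u`, and the gates of a layer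
combine into one such product with `X` on all qubits. Controlling the layer therefore amounts to a
phase gate on the control qubit, five layers without control, and four controlled `X ⊗ ⋯ ⊗ X`. The
latter is a CNOT from the control qubit to `v`, conjugated by a cascade of CNOT gates that
broadcasts `v` over the lattice in depth `O(l₁ + l₂)`. Gates on distant qubits cost `O(l₁ + l₂)`
further layers: a permutation of the lattice is a column, a row and a column permutation (Hall's
theorem), each of which is a pipelined bubble sort, and so the pairs of qubits of a layer can be
moved to consecutive sites of a Hamiltonian path.
-/

namespace QCircuit

section Alternate

variable {M N : Type*} [Monoid M] [Monoid N]

/-- The product of `a 0, …, a 4` in which `a 1` and `a 3` are conjugated by the involution `χ`.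
For `χ = 1` it is the plain product. -/
def alternate (χ : M) (a : Fin 5 → M) : M :=
  a 0 * (χ * a 1 * χ) * a 2 * (χ * a 3 * χ) * a 4

theorem map_alternate (f : M →* N) {χ : M} {χ' : N} (h : ∀ m, f (χ * m * χ) = χ' * f m * χ')
    (a : Fin 5 → M) : f (alternate χ a) = alternate χ' (f ∘ a) := by
  simp only [alternate, Function.comp_apply]
  rw [map_mul, map_mul, h, map_mul, map_mul, h]

theorem alternate_mul_alternate {χ : M} (hχ : χ * χ = 1) {a b : Fin 5 → M}
    (hab : ∀ i j, Commute (a i) (b j)) (hab' : ∀ i j, Commute (χ * a i * χ) (b j)) :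
    alternate χ a * alternate χ b = alternate χ (a * b) := by
  have conj_mul (c d : M) : (χ * c * χ) * (χ * d * χ) = χ * (c * d) * χ := by
    simp only [mul_assoc]
    rw [← mul_assoc χ χ, hχ, one_mul]
  have conj_commute {c d : M} (h : Commute (χ * c * χ) d) : Commute c (χ * d * χ) := by
    have hc : χ * (χ * c * χ) * χ = c := by
      simp only [mul_assoc, hχ, mul_one]
      rw [← mul_assoc, hχ, one_mul]
    rw [commute_iff_eq, ← hc, conj_mul, conj_mul, h.eq]
  have conj_commute_conj {c d : M} (h : Commute c d) : Commute (χ * c * χ) (χ * d * χ) := by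
    rw [commute_iff_eq, conj_mul, conj_mul, h.eq]
  have h₁ : Commute (χ * a 1 * χ) (b 0) := hab' 1 0
  have h₂ : Commute (a 2) (b 0 * (χ * b 1 * χ)) := (hab 2 0).mul_right (conj_commute (hab' 2 1))
  have h₃ : Commute (χ * a 3 * χ) (b 0 * (χ * b 1 * χ) * b 2) :=
    ((hab' 3 0).mul_right (conj_commute_conj (hab 3 1))).mul_right (hab' 3 2)
  have h₄ : Commute (a 4) (b 0 * (χ * b 1 * χ) * b 2 * (χ * b 3 * χ)) :=
    (((hab 4 0).mul_right (conj_commute (hab' 4 1))).mul_right (hab 4 2)).mul_right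
      (conj_commute (hab' 4 3))
  simp only [alternate, Pi.mul_apply, ← conj_mul]
  rw [h₄.mul_mul_mul_comm, h₃.mul_mul_mul_comm, h₂.mul_mul_mul_comm, h₁.mul_mul_mul_comm]

end Alternate

section Unitary

variable {ι : Type*} [Fintype ι] [DecidableEq ι]

open scoped Matrix.Norms.L2Operator in
theorem exists_isHermitian_exp_I_smul_eq (u : Matrix.unitaryGroup ι ℂ) :
    ∃ A : Matrix ι ι ℂ, A.IsHermitian ∧ NormedSpace.exp (Complex.I • A) = u := by
  have hu : (u : Matrix ι ι ℂ) ∈ unitary (Matrix ι ι ℂ) := u.2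
  have := (Matrix.finite_spectrum (u : Matrix ι ι ℂ)).continuousOn Complex.arg
  refine ⟨cfc (Complex.ofReal ∘ Complex.arg) (u : Matrix ι ι ℂ),
    IsSelfAdjoint.cfc_arg (u : Matrix ι ι ℂ), ?_⟩
  rw [← CFC.exp_eq_normedSpace_exp (𝕜 := ℂ), ← cfc_comp_smul .., ← cfc_comp' ..]
  conv_rhs => rw [← cfc_id' ℂ (u : Matrix ι ι ℂ)]
  refine cfc_congr fun z hz => ?_
  have hz : ‖z‖ = 1 := spectrum.norm_eq_one_of_unitary hu hz
  simpa [← Complex.exp_eq_exp_ℂ, hz, mul_comm] using Complex.norm_mul_exp_arg_mul_I z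

/-- The diagonal unitary with diagonal `a`. -/
def diagonalUnitary : (ι → Circle) →* Matrix.unitaryGroup ι ℂ where
  toFun a := ⟨Matrix.diagonal fun i => (a i : ℂ), by
    rw [Matrix.mem_unitaryGroup_iff, Matrix.star_eq_conjTranspose, Matrix.diagonal_conjTranspose,
      Matrix.diagonal_mul_diagonal, ← Matrix.diagonal_one]
    simp [Complex.mul_conj]⟩
  map_one' := Subtype.ext (by simp)
  map_mul' a b := Subtype.ext (by simp)

theorem exists_eq_conj_diagonalUnitary (u : Matrix.unitaryGroup ι ℂ) :
    ∃ (V : Matrix.unitaryGroup ι ℂ) (a : ι → Circle), u = V * diagonalUnitary a * V⁻¹ := by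
  obtain ⟨A, hA, hAu⟩ := exists_isHermitian_exp_I_smul_eq u
  set V := hA.eigenvectorUnitary
  refine ⟨V, fun i => Circle.exp (hA.eigenvalues i), Subtype.ext ?_⟩
  have hinv : (V : Matrix ι ι ℂ)⁻¹ = star (V : Matrix ι ι ℂ) :=
    Matrix.inv_eq_left_inv (Unitary.star_mul_self_of_mem V.2)
  have hV : IsUnit (V : Matrix ι ι ℂ) := (Unitary.toUnits V).isUnit
  rw [← hAu]
  conv_lhs => rw [hA.spectral_theorem, Unitary.conjStarAlgAut_apply]
  rw [← hinv, ← smul_mul_assoc, ← mul_smul_comm, Matrix.exp_conj _ _ hV, ← Matrix.diagonal_smul,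
    Matrix.exp_diagonal, hinv]
  congr 3
  simp [Pi.exp_def, ← Complex.exp_eq_exp_ℂ, mul_comm]

/-- The permutation matrix of `φ` as a unitary. It maps the basis vector `i` to the basis vector
`φ i`, whereas `Equiv.Perm.permMatrix` is its transpose. -/
def permUnitary : Equiv.Perm ι →* Matrix.unitaryGroup ι ℂ where
  toFun φ := ⟨φ⁻¹.permMatrix ℂ, by
    rw [Matrix.mem_unitaryGroup_iff, Matrix.star_eq_conjTranspose, Matrix.conjTranspose_permMatrix,
      ← Matrix.permMatrix_mul, inv_inv, mul_inv_cancel, Matrix.permMatrix_one]⟩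
  map_one' := Subtype.ext (by simp)
  map_mul' φ ψ := Subtype.ext (by simp [Matrix.permMatrix_mul])

theorem permUnitary_mul_coe (φ : Equiv.Perm ι) (A : Matrix ι ι ℂ) :
    (permUnitary φ : Matrix ι ι ℂ) * A = A.submatrix ⇑φ⁻¹ id :=
  PEquiv.toMatrix_toPEquiv_mul _ _

theorem mul_permUnitary_coe (φ : Equiv.Perm ι) (A : Matrix ι ι ℂ) :
    A * (permUnitary φ : Matrix ι ι ℂ) = A.submatrix id φ :=
  PEquiv.mul_toMatrix_toPEquiv _ _

theorem permUnitary_apply (φ : Equiv.Perm ι) (i j : ι) :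
    (permUnitary φ : Matrix ι ι ℂ) i j = if i = φ j then 1 else 0 := by
  rw [← one_mul (permUnitary φ : Matrix ι ι ℂ), mul_permUnitary_coe, Matrix.submatrix_apply,
    Matrix.one_apply, id]

theorem diagonalUnitary_comp (a : ι → Circle) (φ : Equiv.Perm ι) :
    diagonalUnitary (a ∘ φ) = (permUnitary φ)⁻¹ * diagonalUnitary a * permUnitary φ := by
  rw [← map_inv]
  refine Subtype.ext ?_
  rw [Submonoid.coe_mul, Submonoid.coe_mul, permUnitary_mul_coe, mul_permUnitary_coe]
  ext i j
  simp [diagonalUnitary, Matrix.diagonal_apply]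

theorem coe_diagonalUnitary_smul (z : Circle) (a : ι → Circle) :
    (diagonalUnitary (z • a) : Matrix ι ι ℂ) = (z : ℂ) • (diagonalUnitary a : Matrix ι ι ℂ) := by
  ext i j
  simp [diagonalUnitary, Matrix.diagonal_apply]

/-- Diagonal unitaries of the form `r / (r ∘ φ)` are the commutators of `r` and `φ`, so a unitary
is an alternating product as soon as its eigenvalues are, up to a phase, products of two such
quotients, of which the second may be permuted. -/
theorem exists_eq_smul_alternate_permUnitary {φ : Equiv.Perm ι} (hφ : φ⁻¹ = φ) (π : Equiv.Perm ι)
    (h : ∀ a : ι → Circle, ∃ (z : Circle) (r t : ι → Circle),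
      a = z • (r / (r ∘ φ) * (t / (t ∘ φ)) ∘ π))
    (u : Matrix.unitaryGroup ι ℂ) :
    ∃ (z : Circle) (b : Fin 5 → Matrix.unitaryGroup ι ℂ),
      (u : Matrix ι ι ℂ) = (z : ℂ) • (alternate (permUnitary φ) b : Matrix.unitaryGroup ι ℂ) ∧
        alternate 1 b = 1 := by
  obtain ⟨V, a, hu⟩ := exists_eq_conj_diagonalUnitary u
  obtain ⟨z, r, t, ha⟩ := h a
  have hcommutator (r : ι → Circle) : diagonalUnitary (r / (r ∘ φ)) =
      diagonalUnitary r * (permUnitary φ * (diagonalUnitary r)⁻¹ * permUnitary φ) := by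
    have hinv : (permUnitary φ)⁻¹ = permUnitary φ := by rw [← map_inv, hφ]
    rw [map_div, diagonalUnitary_comp, div_eq_mul_inv, mul_inv_rev, mul_inv_rev, inv_inv, hinv]
    simp only [mul_assoc]
  refine ⟨z, ![V * diagonalUnitary r, (diagonalUnitary r)⁻¹,
    (permUnitary π)⁻¹ * diagonalUnitary t, (diagonalUnitary t)⁻¹, permUnitary π * V⁻¹], ?_, ?_⟩
  · rw [hu, ha, Submonoid.coe_mul, Submonoid.coe_mul, coe_diagonalUnitary_smul, mul_smul_comm,
      smul_mul_assoc, ← Submonoid.coe_mul, ← Submonoid.coe_mul, map_mul, diagonalUnitary_comp,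
      hcommutator, hcommutator]
    simp only [alternate, Matrix.cons_val, mul_assoc]
  · simp only [alternate, Matrix.cons_val]
    group

end Unitary

theorem exists_circle_pow_eq (w : Circle) {n : ℕ} (hn : n ≠ 0) : ∃ z : Circle, z ^ n = w := by
  refine ⟨Circle.exp (Complex.arg w / n), ?_⟩
  rw [← Circle.exp_nsmul, nsmul_eq_mul, mul_div_cancel₀ _ (by exact_mod_cast hn), Circle.exp_arg]

theorem exists_eq_smul_alternate_bool (u : Matrix.unitaryGroup Bool ℂ) :
    ∃ (z : Circle) (b : Fin 5 → Matrix.unitaryGroup Bool ℂ),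
      (u : Matrix Bool Bool ℂ) = (z : ℂ) •
        (alternate (permUnitary Equiv.boolNot) b : Matrix.unitaryGroup Bool ℂ) ∧
      alternate 1 b = 1 := by
  refine exists_eq_smul_alternate_permUnitary rfl 1 (fun a => ?_) u
  obtain ⟨z, hz⟩ := exists_circle_pow_eq (a false * a true) two_ne_zero
  refine ⟨z, fun i => if i then 1 else a false / z, 1, funext fun i => ?_⟩
  cases i
  · simp
  · simp [← pow_two, hz, mul_div_assoc']

theorem exists_eq_smul_alternate_bool_prod (u : Matrix.unitaryGroup (Bool × Bool) ℂ) :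
    ∃ (z : Circle) (b : Fin 5 → Matrix.unitaryGroup (Bool × Bool) ℂ),
      (u : Matrix (Bool × Bool) (Bool × Bool) ℂ) = (z : ℂ) •
        (alternate (permUnitary (Equiv.boolNot.prodCongr Equiv.boolNot)) b :
          Matrix.unitaryGroup (Bool × Bool) ℂ) ∧
      alternate 1 b = 1 := by
  refine exists_eq_smul_alternate_permUnitary rfl (Equiv.swap (false, true) (true, true))
    (fun a => ?_) u
  obtain ⟨z, hz⟩ := exists_circle_pow_eq
    (a (false, false) * a (false, true) * a (true, false) * a (true, true)) four_ne_zero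
  have ha : a (true, true) = z ^ 4 / (a (false, false) * a (false, true) * a (true, false)) := by
    rw [hz]
    simp
  refine ⟨z, fun i => if i.1 then 1 else a i / z,
    fun i => if i = (false, true) then z ^ 2 / (a (false, true) * a (true, false)) else 1,
    funext ?_⟩
  rintro ⟨_ | _, _ | _⟩
  · simp [Equiv.swap_apply_def]
  · simp
  · change a (true, false) =
      z * (1 / (a (false, true) / z) * (1 / (z ^ 2 / (a (false, true) * a (true, false)))))
    apply Circle.ext
    push_cast
    field_simp
  · change a (true, true) =
      z * (1 / (a (false, false) / z) * (z ^ 2 / (a (false, true) * a (true, false)) / 1))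
    rw [ha]
    apply Circle.ext
    push_cast
    field_simp

theorem basis_eq_iff {P Q : Type*} (f : P ↪ Q) {x y : Basis Q} :
    x = y ↔ (∀ r, r ∉ Set.range f → x r = y r) ∧ x ∘ f = y ∘ f := by
  refine ⟨by rintro rfl; simp, fun ⟨h, h'⟩ => funext fun r => ?_⟩
  by_cases hr : r ∈ Set.range f
  · obtain ⟨p, rfl⟩ := hr
    exact congrFun h' p
  · exact h r hr

/-- The negation of the bits in `S`. -/
def flipOn {Q : Type*} [DecidableEq Q] (S : Finset Q) : Equiv.Perm (Basis Q) :=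
  Function.Involutive.toPerm (fun x r => x r ^^ decide (r ∈ S)) fun x => by simp

theorem flipOn_apply {Q : Type*} [DecidableEq Q] (S : Finset Q) (x : Basis Q) (r : Q) :
    flipOn S x r = (x r ^^ decide (r ∈ S)) :=
  rfl

theorem flipOn_inv {Q : Type*} [DecidableEq Q] (S : Finset Q) : (flipOn S)⁻¹ = flipOn S :=
  rfl

section Extend

variable {P Q : Type*} [Fintype P] [DecidableEq P] [Fintype Q] [DecidableEq Q]

theorem sum_ite_eqOn_compl_range (f : P ↪ Q) (x : Basis Q) {R : Type*} [AddCommMonoid R]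
    (F : Basis Q → R) :
    ∑ z, (if ∀ r, r ∉ Set.range f → x r = z r then F z else 0) =
      ∑ w : Basis P, F (Function.extend f w x) := by
  rw [← Finset.sum_filter]
  have hext (w : Basis P) : Function.extend f w x ∘ f = w :=
    funext fun p => f.injective.extend_apply w x p
  refine Finset.sum_nbij' (fun z => z ∘ f) (fun w => Function.extend f w x) (by simp) ?_ ?_
    (fun w _ => hext w) ?_
  · intro w _
    simp only [Finset.mem_filter, Finset.mem_univ, true_and]
    exact fun r hr => (Function.extend_apply' w x r hr).symm
  all_goals
    intro z hz
    have hz : Function.extend f (z ∘ f) x = z := by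
      funext r
      by_cases hr : r ∈ Set.range f
      · obtain ⟨p, rfl⟩ := hr
        exact f.injective.extend_apply _ _ _
      · rw [Function.extend_apply' _ _ _ hr, (Finset.mem_filter.1 hz).2 r hr]
    simp only [hz]

/-- The operator on the register `Q` that acts as `A` on the qubits `f p`, in the place of the
qubits `p` of `P`, and is tensored with the identity on all other qubits. -/
def extend (f : P ↪ Q) : Op P →⋆ₐ[ℂ] Op Q where
  toFun A := Matrix.of fun x y =>
    if ∀ r, r ∉ Set.range f → x r = y r then A (x ∘ f) (y ∘ f) else 0
  map_zero' := by ext; simp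
  map_add' A B := by ext; simp only [Matrix.of_apply, Matrix.add_apply, ← ite_add_zero]
  map_one' := by ext; simp only [Matrix.of_apply, Matrix.one_apply, basis_eq_iff f, ite_and]
  map_mul' A B := by
    ext x y
    have hagree (w : Basis P) : (∀ r, r ∉ Set.range f → Function.extend f w x r = y r) ↔
        ∀ r, r ∉ Set.range f → x r = y r :=
      forall₂_congr fun r hr => by rw [Function.extend_apply' _ _ _ hr]
    simp only [Matrix.of_apply, Matrix.mul_apply, ite_mul, zero_mul,
      sum_ite_eqOn_compl_range f x, hagree, Function.extend_comp f.injective]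
    split_ifs <;> simp
  commutes' c := by
    ext
    simp only [Matrix.of_apply, Matrix.algebraMap_matrix_apply, basis_eq_iff f, ite_and]
  map_star' A := by
    ext x y
    simp only [Matrix.of_apply, Matrix.star_apply, eq_comm (a := x _), apply_ite star, star_zero]

theorem extend_apply (f : P ↪ Q) (A : Op P) (x y : Basis Q) :
    extend f A x y = if ∀ r, r ∉ Set.range f → x r = y r then A (x ∘ f) (y ∘ f) else 0 :=
  rfl

theorem extend_mul_extend_apply {R : Type*} [Fintype R] [DecidableEq R] {f : P ↪ Q} {g : R ↪ Q}
    (h : Disjoint (Set.range f) (Set.range g)) (A : Op P) (B : Op R) (x y : Basis Q) :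
    (extend f A * extend g B) x y =
      if ∀ r, r ∉ Set.range f → r ∉ Set.range g → x r = y r then
        A (x ∘ f) (y ∘ f) * B (x ∘ g) (y ∘ g) else 0 := by
  have hg (w : Basis P) : Function.extend f w x ∘ g = x ∘ g :=
    funext fun p => Function.extend_apply' _ _ _ fun hp =>
      Set.disjoint_left.1 h hp (Set.mem_range_self p)
  have hagree (w : Basis P) : (∀ r, r ∉ Set.range g → Function.extend f w x r = y r) ↔
      w = y ∘ f ∧ ∀ r, r ∉ Set.range f → r ∉ Set.range g → x r = y r := by
    refine ⟨fun hw => ⟨funext fun p => ?_, fun r hf hg => ?_⟩, ?_⟩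
    · rw [← f.injective.extend_apply w x p]
      exact hw _ (Set.disjoint_left.1 h (Set.mem_range_self p))
    · rw [← hw r hg, Function.extend_apply' _ _ _ hf]
    · rintro ⟨rfl, hxy⟩ r hr
      by_cases hf : r ∈ Set.range f
      · obtain ⟨p, rfl⟩ := hf
        exact f.injective.extend_apply _ _ _
      · rw [Function.extend_apply' _ _ _ hf, hxy r hf hr]
  simp only [Matrix.mul_apply, extend_apply, ite_mul, zero_mul, sum_ite_eqOn_compl_range f x]
  simp only [Function.extend_comp f.injective, hg, hagree, ite_and, mul_ite, mul_zero,
    Finset.sum_ite_eq', Finset.mem_univ, if_true]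

theorem commute_extend {R : Type*} [Fintype R] [DecidableEq R] {f : P ↪ Q} {g : R ↪ Q}
    (h : Disjoint (Set.range f) (Set.range g)) (A : Op P) (B : Op R) :
    Commute (extend f A) (extend g B) := by
  ext x y
  rw [extend_mul_extend_apply h, extend_mul_extend_apply h.symm, mul_comm]
  exact if_congr (forall_congr' fun r => forall_comm) rfl rfl

/-- The Pauli operator `X` on each of the qubits in `S`. -/
noncomputable def pauliX (S : Finset Q) : Op Q := (permUnitary (flipOn S) : Op Q)

theorem pauliX_mul_self (S : Finset Q) : pauliX S * pauliX S = 1 := by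
  have h : flipOn S * flipOn S = 1 := inv_eq_iff_mul_eq_one.1 (flipOn_inv S)
  rw [pauliX, ← Submonoid.coe_mul, ← map_mul, h, map_one, Submonoid.coe_one]

theorem pauliX_mul_mul_pauliX (S : Finset Q) (A : Op Q) :
    pauliX S * A * pauliX S = A.submatrix (flipOn S) (flipOn S) := by
  rw [pauliX, permUnitary_mul_coe, mul_permUnitary_coe, flipOn_inv]
  rfl

theorem pauliX_univ_conj_extend (f : P ↪ Q) (A : Op P) :
    pauliX Finset.univ * extend f A * pauliX Finset.univ =
      extend f (pauliX Finset.univ * A * pauliX Finset.univ) := by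
  ext x y
  simp only [pauliX_mul_mul_pauliX, Matrix.submatrix_apply, extend_apply, flipOn_apply,
    Finset.mem_univ, decide_true, Bool.xor_true, Bool.not_inj_iff]
  congr 2 <;> funext p <;> simp only [Function.comp_apply, flipOn_apply, Finset.mem_univ]

/-- `A` acts on the qubits in `S` and is tensored with the identity on all others. The coordinate
`Fin k` on the qubits in `S` is arbitrary. -/
def ActsOn (S : Set Q) (A : Op Q) : Prop :=
  ∃ (k : ℕ) (f : Fin k ↪ Q) (B : Op (Fin k)), Set.range f = S ∧ A = extend f B

theorem ActsOn.commute {S T : Set Q} {A B : Op Q} (hA : ActsOn S A) (hB : ActsOn T B)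
    (h : Disjoint S T) : Commute A B := by
  obtain ⟨k, f, A, rfl, rfl⟩ := hA
  obtain ⟨l, g, B, rfl, rfl⟩ := hB
  exact commute_extend h A B

theorem ActsOn.pauliX_univ_conj {S : Set Q} {A : Op Q} (hA : ActsOn S A) :
    ActsOn S (pauliX Finset.univ * A * pauliX Finset.univ) := by
  obtain ⟨k, f, A, rfl, rfl⟩ := hA
  exact ⟨k, f, _, rfl, pauliX_univ_conj_extend f A⟩

end Extend

section Gate

/-- Relabelling of the rows and columns of matrices. -/
def reindexHom {ι κ : Type*} [Fintype ι] [DecidableEq ι] [Fintype κ] [DecidableEq κ] (e : ι ≃ κ) :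
    Matrix ι ι ℂ →⋆ₐ[ℂ] Matrix κ κ ℂ where
  __ := (Matrix.reindexAlgEquiv ℂ ℂ e).toAlgHom
  map_star' _ := rfl

theorem reindexHom_apply {ι κ : Type*} [Fintype ι] [DecidableEq ι] [Fintype κ] [DecidableEq κ]
    (e : ι ≃ κ) (A : Matrix ι ι ℂ) (x y : κ) : reindexHom e A x y = A (e.symm x) (e.symm y) :=
  rfl

variable {Q : Type*} [Fintype Q] [DecidableEq Q]

/-- `applyOne q` as a homomorphism. -/
def applyOneHom (q : Q) : Matrix Bool Bool ℂ →⋆ₐ[ℂ] Op Q :=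
  (extend (⟨![q], Function.injective_of_subsingleton _⟩ : Fin 1 ↪ Q)).comp
    (reindexHom (Equiv.funUnique (Fin 1) Bool).symm)

/-- `applyTwo p q` as a homomorphism. -/
def applyTwoHom {p q : Q} (hpq : p ≠ q) : Matrix (Bool × Bool) (Bool × Bool) ℂ →⋆ₐ[ℂ] Op Q :=
  (extend (⟨![p, q], by simpa [Function.Injective, Fin.forall_fin_two] using ⟨hpq, hpq.symm⟩⟩ :
    Fin 2 ↪ Q)).comp
    (reindexHom (finTwoArrowEquiv Bool).symm)

theorem Gate.op_one (q : Q) (u : Matrix.unitaryGroup Bool ℂ) :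
    (Gate.one q u).op = applyOneHom q u := by
  ext x y
  simp only [Gate.op, applyOneHom, StarAlgHom.comp_apply, extend_apply, applyOne]
  exact if_congr (by simp) rfl rfl

theorem Gate.op_two {p q : Q} (hpq : p ≠ q) (u : Matrix.unitaryGroup (Bool × Bool) ℂ) :
    (Gate.two p q hpq u).op = applyTwoHom hpq u := by
  ext x y
  simp only [Gate.op, applyTwoHom, StarAlgHom.comp_apply, extend_apply, applyTwo]
  exact if_congr (by simp; grind) rfl rfl

theorem Gate.actsOn (g : Gate Q) : ActsOn g.support g.op := by
  cases g with
  | one q u => exact ⟨1, _, _, by simp [Gate.support], Gate.op_one q u⟩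
  | two p q hpq u => exact ⟨2, _, _, by simp [Gate.support, Set.pair_comm], Gate.op_two hpq u⟩

theorem Gate.op_mem_unitaryGroup (g : Gate Q) : g.op ∈ Matrix.unitaryGroup (Basis Q) ℂ := by
  cases g with
  | one q u => exact Gate.op_one q u ▸ Unitary.map_mem (applyOneHom q) u.2
  | two p q hpq u => exact Gate.op_two hpq u ▸ Unitary.map_mem (applyTwoHom hpq) u.2

/-- The inverse gate. -/
def Gate.inv {Q : Type*} : Gate Q → Gate Q
  | .one q u => .one q u⁻¹
  | .two p q hpq u => .two p q hpq u⁻¹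

theorem Gate.inv_op (g : Gate Q) : g.inv.op = star g.op := by
  cases g with
  | one q u => rw [Gate.inv, Gate.op_one, Gate.op_one, ← map_star]; rfl
  | two p q hpq u => rw [Gate.inv, Gate.op_two, Gate.op_two, ← map_star]; rfl

/-- A homomorphism restricted to the unitary group. -/
def unitaryRestrict {ι : Type*} [Fintype ι] [DecidableEq ι] (f : Matrix ι ι ℂ →⋆ₐ[ℂ] Op Q) :
    Matrix.unitaryGroup ι ℂ →* Op Q :=
  (f : Matrix ι ι ℂ →* Op Q).comp (Matrix.unitaryGroup ι ℂ).subtype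

theorem map_smul_alternate_permUnitary {ι : Type*} [Fintype ι] [DecidableEq ι] {φ : Equiv.Perm ι}
    (hφ : φ⁻¹ = φ) (f : Matrix ι ι ℂ →⋆ₐ[ℂ] Op Q) {χ : Op Q}
    (hf : ∀ m, f (m.submatrix φ φ) = χ * f m * χ) (z : ℂ) (b : Fin 5 → Matrix.unitaryGroup ι ℂ) :
    f (z • (alternate (permUnitary φ) b : Matrix.unitaryGroup ι ℂ)) =
      z • alternate χ (fun i => f (b i)) := by
  rw [map_smul]
  refine congrArg (z • ·) (map_alternate (unitaryRestrict f) (fun m => ?_) b)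
  refine Eq.trans (congrArg f ?_) (hf m)
  simp [permUnitary_mul_coe, mul_permUnitary_coe, hφ]

theorem map_alternate_one {ι : Type*} [Fintype ι] [DecidableEq ι] (f : Matrix ι ι ℂ →⋆ₐ[ℂ] Op Q)
    {b : Fin 5 → Matrix.unitaryGroup ι ℂ} (hb : alternate 1 b = 1) :
    alternate 1 (fun i => f (b i)) = 1 := by
  have h := map_alternate (unitaryRestrict f) (χ := 1) (χ' := 1) (by simp) b
  rw [hb, map_one] at h
  exact h.symm

theorem pauliX_univ_conj_applyOneHom (q : Q) (m : Matrix Bool Bool ℂ) :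
    applyOneHom q (m.submatrix Equiv.boolNot Equiv.boolNot) =
      pauliX Finset.univ * applyOneHom q m * pauliX Finset.univ := by
  rw [applyOneHom, StarAlgHom.comp_apply, StarAlgHom.comp_apply, pauliX_univ_conj_extend,
    pauliX_mul_mul_pauliX]
  congr 1
  ext x y
  simp only [reindexHom_apply, Matrix.submatrix_apply]
  congr 1 <;> simp [flipOn_apply]

theorem pauliX_univ_conj_applyTwoHom {p q : Q} (hpq : p ≠ q)
    (m : Matrix (Bool × Bool) (Bool × Bool) ℂ) :
    applyTwoHom hpq (m.submatrix (Equiv.boolNot.prodCongr Equiv.boolNot)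
        (Equiv.boolNot.prodCongr Equiv.boolNot)) =
      pauliX Finset.univ * applyTwoHom hpq m * pauliX Finset.univ := by
  rw [applyTwoHom, StarAlgHom.comp_apply, StarAlgHom.comp_apply, pauliX_univ_conj_extend,
    pauliX_mul_mul_pauliX]
  congr 1
  ext x y
  simp only [reindexHom_apply, Matrix.submatrix_apply]
  congr 1 <;> simp [flipOn_apply]

theorem Gate.exists_alternate (g : Gate Q) :
    ∃ (z : Circle) (a : Fin 5 → Gate Q),
      (∀ i, (a i).support = g.support ∧ ∀ G, g.Under G → (a i).Under G) ∧
      g.op = (z : ℂ) • alternate (pauliX Finset.univ) (Gate.op ∘ a) ∧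
      alternate 1 (Gate.op ∘ a) = 1 := by
  cases g with
  | one q u =>
    obtain ⟨z, b, hu, hb⟩ := exists_eq_smul_alternate_bool u
    refine ⟨z, fun i => .one q (b i), fun i => ⟨rfl, fun _ => id⟩, ?_, ?_⟩
    · simp only [Function.comp_def, Gate.op_one]
      rw [hu]
      exact map_smul_alternate_permUnitary (φ := Equiv.boolNot) rfl _
        (pauliX_univ_conj_applyOneHom q) _ _
    · simp only [Function.comp_def, Gate.op_one, map_alternate_one _ hb]
  | two p q hpq u =>
    obtain ⟨z, b, hu, hb⟩ := exists_eq_smul_alternate_bool_prod u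
    refine ⟨z, fun i => .two p q hpq (b i), fun i => ⟨rfl, fun _ => id⟩, ?_, ?_⟩
    · simp only [Function.comp_def, Gate.op_two]
      rw [hu]
      exact map_smul_alternate_permUnitary (φ := Equiv.boolNot.prodCongr Equiv.boolNot) rfl _
        (pauliX_univ_conj_applyTwoHom hpq) _ _
    · simp only [Function.comp_def, Gate.op_two, map_alternate_one _ hb]

end Gate

theorem list_prod_map_smul {α R A : Type*} [CommMonoid R] [Monoid A] [MulAction R A]
    [IsScalarTower R A A] [SMulCommClass R A A] (z : α → R) (a : α → A) (l : List α) :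
    (l.map fun i => z i • a i).prod = (l.map z).prod • (l.map a).prod := by
  induction l with
  | nil => simp
  | cons i l ih => simp only [List.map_cons, List.prod_cons, ih, smul_mul_smul_comm]

section Layer

variable {Q : Type*} {G : SimpleGraph Q}

/-- The gates of the layer respect the connectivity graph `G`. -/
def Layer.Under (G : SimpleGraph Q) (L : Layer Q) : Prop :=
  ∀ g ∈ L.gates, g.Under G

/-- The layer that consists of the images of the gates of `L`. -/
def Layer.mapGates {P : Type*} (L : Layer P) (φ : Gate P → Gate Q)
    (hφ : ∀ g h, Disjoint g.support h.support → Disjoint (φ g).support (φ h).support) :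
    Layer Q where
  gates := L.gates.map φ
  disjoint := List.pairwise_map.2 (L.disjoint.imp (hφ _ _))

theorem Layer.Under.mapGates {P : Type*} {H : SimpleGraph P} {L : Layer P} (hL : L.Under H)
    {φ : Gate P → Gate Q}
    {hφ : ∀ g h, Disjoint g.support h.support → Disjoint (φ g).support (φ h).support}
    (hG : ∀ g, g.Under H → (φ g).Under G) : (L.mapGates φ hφ).Under G :=
  List.forall_mem_map.2 fun g hg => hG g (hL g hg)

/-- The layer of the inverse gates. -/
def Layer.inv (L : Layer Q) : Layer Q where
  gates := (L.gates.map Gate.inv).reverse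
  disjoint := by
    rw [List.pairwise_reverse, List.pairwise_map]
    refine L.disjoint.imp fun {g h} hgh => ?_
    cases g <;> cases h <;> exact hgh.symm

theorem Layer.Under.inv {L : Layer Q} (hL : L.Under G) : L.inv.Under G := by
  intro g hg
  obtain ⟨h, hh, rfl⟩ := List.mem_map.1 (List.mem_reverse.1 hg)
  have := hL h hh
  cases h <;> exact this

variable [Fintype Q] [DecidableEq Q]

theorem Layer.mapGates_op {P : Type*} (L : Layer P) (φ : Gate P → Gate Q)
    (hφ : ∀ g h, Disjoint g.support h.support → Disjoint (φ g).support (φ h).support) :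
    (L.mapGates φ hφ).op = (L.gates.map (Gate.op ∘ φ)).prod := by
  rw [Layer.op, Layer.mapGates, List.map_map]

theorem Layer.inv_op (L : Layer Q) : L.inv.op = star L.op := by
  rw [Layer.op, Layer.op, Matrix.star_eq_conjTranspose, Matrix.conjTranspose_list_prod,
    List.map_map, Layer.inv, List.map_reverse, List.map_map]
  exact congrArg (fun f => (List.map f L.gates).reverse.prod) (funext Gate.inv_op)

theorem Layer.op_mem_unitaryGroup (L : Layer Q) : L.op ∈ Matrix.unitaryGroup (Basis Q) ℂ :=
  list_prod_mem (List.forall_mem_map.2 fun g _ => g.op_mem_unitaryGroup)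

theorem list_prod_map_alternate {χ : Op Q} (hχ : χ * χ = 1) {l : List (Gate Q)}
    (hl : l.Pairwise fun g h => Disjoint g.support h.support) {a : Gate Q → Fin 5 → Op Q}
    (ha : ∀ g i, ActsOn g.support (a g i)) (ha' : ∀ g i, ActsOn g.support (χ * a g i * χ)) :
    (l.map fun g => alternate χ (a g)).prod = alternate χ fun i => (l.map (a · i)).prod := by
  induction l with
  | nil => simp [alternate, hχ]
  | cons g l ih =>
    rw [List.pairwise_cons] at hl
    rw [List.map_cons, List.prod_cons, ih hl.2, alternate_mul_alternate hχ]
    · rfl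
    all_goals
      intro i j
      refine Commute.list_prod_right _ _ (List.forall_mem_map.2 fun h hh => ?_)
    exacts [(ha g i).commute (ha h j) (hl.1 h hh), (ha' g i).commute (ha h j) (hl.1 h hh)]

theorem Layer.exists_alternate (L : Layer Q) :
    ∃ (z : Circle) (A : Fin 5 → Layer Q),
      (∀ i G, L.Under G → (A i).Under G) ∧
      L.op = (z : ℂ) • alternate (pauliX Finset.univ) (Layer.op ∘ A) ∧
      alternate 1 (Layer.op ∘ A) = 1 := by
  choose z a ha hop hone using Gate.exists_alternate (Q := Q)
  refine ⟨(L.gates.map z).prod, fun i => L.mapGates (fun g => a g i) fun g h hgh => ?_, ?_, ?_, ?_⟩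
  · rwa [(ha g i).1, (ha h i).1]
  · exact fun i G hL => hL.mapGates fun g => (ha g i).2 G
  · have hz : ((L.gates.map z).prod : ℂ) = (L.gates.map fun g => (z g : ℂ)).prod :=
      (map_list_prod Circle.coeHom _).trans (by rw [List.map_map]; rfl)
    rw [Layer.op, funext hop, list_prod_map_smul, hz,
      list_prod_map_alternate (pauliX_mul_self _) L.disjoint]
    · simp only [Function.comp_def, Layer.mapGates_op]
    · exact fun g i => (ha g i).1 ▸ (a g i).actsOn
    · exact fun g i => (ha g i).1 ▸ (a g i).actsOn.pauliX_univ_conj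
  · simp only [Function.comp_def, Layer.mapGates_op]
    refine Eq.trans (list_prod_map_alternate (one_mul 1) L.disjoint ?_ ?_).symm ?_
    · exact fun g i => (ha g i).1 ▸ (a g i).actsOn
    · exact fun g i => by simpa only [one_mul, mul_one] using (ha g i).1 ▸ (a g i).actsOn
    · exact List.prod_eq_one (List.forall_mem_map.2 fun g _ => hone g)

end Layer

section Implements

variable {Q : Type*} [Fintype Q] [DecidableEq Q]

theorem Circuit.op_mem_unitaryGroup (C : Circuit Q) : C.op ∈ Matrix.unitaryGroup (Basis Q) ℂ := by
  refine list_prod_mem fun A hA => ?_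
  obtain ⟨L, -, rfl⟩ := List.mem_map.1 (List.mem_reverse.1 hA)
  exact L.op_mem_unitaryGroup

/-- Some circuit of depth at most `k` that is constrained to `G` implements the operator `A`. -/
def Implements (G : SimpleGraph Q) (k : ℕ) (A : Op Q) : Prop :=
  ∃ W : Circuit Q, W.Under G ∧ W.depth ≤ k ∧ W.op = A

namespace Implements

variable {G : SimpleGraph Q} {k l : ℕ} {A B : Op Q}

theorem one (G : SimpleGraph Q) (k : ℕ) : Implements G k (1 : Op Q) :=
  ⟨[], List.forall_mem_nil _, k.zero_le, rfl⟩

theorem mono (hA : Implements G k A) (hkl : k ≤ l) : Implements G l A :=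
  let ⟨W, hG, hk, hop⟩ := hA
  ⟨W, hG, hk.trans hkl, hop⟩

theorem mul (hA : Implements G k A) (hB : Implements G l B) : Implements G (k + l) (A * B) := by
  obtain ⟨V, hVG, hVk, rfl⟩ := hA
  obtain ⟨W, hWG, hWl, rfl⟩ := hB
  refine ⟨W ++ V, List.forall_mem_append.2 ⟨hWG, hVG⟩, ?_, ?_⟩
  · rw [Circuit.depth, List.length_append, add_comm]
    exact add_le_add hVk hWl
  · simp only [Circuit.op, List.map_append, List.reverse_append, List.prod_append]

theorem layer {L : Layer Q} (hL : L.Under G) : Implements G 1 L.op :=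
  ⟨[L], List.forall_mem_singleton.2 hL, le_rfl, mul_one _⟩

theorem gate {g : Gate Q} (hg : g.Under G) : Implements G 1 g.op := by
  have h := layer (L := ⟨[g], List.pairwise_singleton _ _⟩) (List.forall_mem_singleton.2 hg)
  rwa [Layer.op, List.map_singleton, List.prod_singleton] at h

theorem star (hA : Implements G k A) : Implements G k (star A) := by
  obtain ⟨W, hG, hk, rfl⟩ := hA
  refine ⟨(W.map Layer.inv).reverse, fun L hL => ?_, ?_, ?_⟩
  · obtain ⟨L', hL', rfl⟩ := List.mem_map.1 (List.mem_reverse.1 hL)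
    exact Layer.Under.inv (hG L' hL')
  · rwa [Circuit.depth, List.length_reverse, List.length_map]
  · rw [Circuit.op, Circuit.op, Matrix.star_eq_conjTranspose, Matrix.conjTranspose_list_prod,
      List.map_reverse, List.map_reverse, List.reverse_reverse, List.reverse_reverse, List.map_map,
      List.map_map]
    exact congrArg (fun f => (List.map f W).prod) (funext Layer.inv_op)

theorem mem_unitaryGroup (hA : Implements G k A) : A ∈ Matrix.unitaryGroup (Basis Q) ℂ := by
  obtain ⟨W, -, -, rfl⟩ := hA
  exact W.op_mem_unitaryGroup

end Implements

end Implements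

section Map

variable {P Q R : Type*}

/-- The gate on the qubits `f p` in the place of the qubits `p`. -/
def Gate.map (f : P ↪ Q) : Gate P → Gate Q
  | .one p u => .one (f p) u
  | .two p q hpq u => .two (f p) (f q) (f.injective.ne hpq) u

theorem Gate.map_support (f : P ↪ Q) (g : Gate P) : (g.map f).support = f '' g.support := by
  cases g <;> simp [Gate.map, Gate.support, Set.image_pair]

/-- The layer of the gates on the qubits `f p` in the place of the qubits `p`. -/
def Layer.map (f : P ↪ Q) (L : Layer P) : Layer Q :=
  L.mapGates (Gate.map f) fun g h hgh => by
    simpa only [Gate.map_support, Set.disjoint_image_iff f.injective] using hgh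

variable [Fintype P] [DecidableEq P] [Fintype Q] [DecidableEq Q]

theorem extend_extend [Fintype R] [DecidableEq R] (f : P ↪ Q) (g : R ↪ P) (A : Op R) :
    extend f (extend g A) = extend (g.trans f) A := by
  ext x y
  simp only [extend_apply, ← ite_and]
  refine if_congr ⟨?_, ?_⟩ rfl rfl
  · rintro ⟨hf, hg⟩ r hr
    by_cases hrf : r ∈ Set.range f
    · obtain ⟨p, rfl⟩ := hrf
      exact hg p fun ⟨s, hs⟩ => hr ⟨s, congrArg f hs⟩
    · exact hf r hrf
  · refine fun h => ⟨fun r hr => h r fun ⟨s, hs⟩ => hr ⟨g s, hs⟩, fun p hp => h (f p) ?_⟩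
    exact fun ⟨s, hs⟩ => hp ⟨s, f.injective hs⟩

theorem Gate.map_op (f : P ↪ Q) (g : Gate P) : (g.map f).op = extend f g.op := by
  cases g with
  | one p u =>
    rw [Gate.map, Gate.op_one, Gate.op_one, applyOneHom, applyOneHom, StarAlgHom.comp_apply,
      StarAlgHom.comp_apply, extend_extend]
    congr 2
    ext i
    fin_cases i
    rfl
  | two p q hpq u =>
    rw [Gate.map, Gate.op_two, Gate.op_two, applyTwoHom, applyTwoHom, StarAlgHom.comp_apply,
      StarAlgHom.comp_apply, extend_extend]
    congr 2
    ext i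
    fin_cases i <;> rfl

theorem Layer.map_op (f : P ↪ Q) (L : Layer P) : (L.map f).op = extend f L.op := by
  rw [Layer.map, Layer.mapGates_op, Layer.op, map_list_prod, List.map_map]
  exact congrArg (fun F => (List.map F L.gates).prod) (funext (Gate.map_op f))

theorem Implements.extend {G : SimpleGraph P} {H : SimpleGraph Q} {f : P ↪ Q}
    (hf : ∀ p q, G.Adj p q → H.Adj (f p) (f q)) {k : ℕ} {A : Op P} (hA : Implements G k A) :
    Implements H k (extend f A) := by
  obtain ⟨W, hG, hk, rfl⟩ := hA
  refine ⟨W.map (Layer.map f), ?_, by rwa [Circuit.depth, List.length_map], ?_⟩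
  · refine List.forall_mem_map.2 fun L hL => Layer.Under.mapGates (hG L hL) fun g hg => ?_
    cases g with
    | one p u => trivial
    | two p q hpq u => exact hf p q hg
  · rw [Circuit.op, Circuit.op, map_list_prod, List.map_reverse, List.map_map, List.map_map]
    exact congrArg (fun F => (List.map F W).reverse.prod) (funext (Layer.map_op f))

end Map

section Controlled

variable {Q : Type*} [Fintype Q]

/-- The operator that applies `A` to `Q` if the control qubit is `|0⟩`, and `B` if it is `|1⟩`. -/
def block (A B : Op Q) : Op (Option Q) := fun x y =>
  if x none = y none then
    (if x none = true then B else A) (fun q => x (some q)) (fun q => y (some q))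
  else 0

theorem controlled_eq_block (U : Op Q) : controlled U = block 1 U := by
  ext x y
  simp only [controlled, block]
  split_ifs <;> simp_all [Matrix.one_apply]

variable [DecidableEq Q]

theorem block_mul_block (A B A' B' : Op Q) :
    block A B * block A' B' = block (A * A') (B * B') := by
  ext x y
  rw [Matrix.mul_apply, ← (Equiv.piOptionEquivProd (β := fun _ => Bool)).symm.sum_comp,
    Fintype.sum_prod_type, Fintype.sum_bool]
  cases hx : x none <;> cases hy : y none <;>
    simp [block, Equiv.piOptionEquivProd, hx, hy, Matrix.mul_apply]

theorem extend_some_eq_block (A : Op Q) : extend Function.Embedding.some A = block A A := by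
  ext x y
  simp only [extend_apply, block, ite_self, Option.forall]
  exact if_congr (by simp) rfl rfl

theorem controlled_one {Q : Type*} [Fintype Q] : controlled (1 : Op Q) = 1 := by
  classical
  rw [controlled_eq_block, ← extend_some_eq_block, map_one]

theorem controlled_mul (A B : Op Q) : controlled (A * B) = controlled A * controlled B := by
  simp only [controlled_eq_block, block_mul_block, one_mul]

theorem controlled_conj {A : Op Q} (hA : A ∈ Matrix.unitaryGroup (Basis Q) ℂ) (U : Op Q) :
    controlled (A * U * star A) =
      extend Function.Embedding.some A * controlled U *
        extend Function.Embedding.some (star A) := by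
  simp only [controlled_eq_block, extend_some_eq_block, block_mul_block, mul_one,
    Unitary.mul_star_self_of_mem hA]

theorem controlled_alternate (χ : Op Q) {a : Fin 5 → Op Q} (ha : alternate 1 a = 1) :
    controlled (alternate χ a) =
      alternate (controlled χ) (extend Function.Embedding.some ∘ a) := by
  simp only [alternate, one_mul, mul_one] at ha
  simp only [alternate, Function.comp_apply, controlled_eq_block, extend_some_eq_block,
    block_mul_block, one_mul, mul_one, ha]

theorem controlled_circle_smul (z : Circle) (A : Op Q) :
    controlled ((z : ℂ) • A) =
      (Gate.one none (diagonalUnitary fun b => if b then z else 1)).op * controlled A := by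
  have hone : controlled ((z : ℂ) • (1 : Op Q)) =
      (Gate.one none (diagonalUnitary fun b => if b then z else 1)).op := by
    ext x y
    simp only [controlled, Gate.op, applyOne, diagonalUnitary, Option.forall, funext_iff]
    cases hx : x none <;> cases hy : y none <;> simp [Matrix.one_apply, funext_iff]
  rw [← hone, ← controlled_mul, smul_mul_assoc, one_mul]

theorem Implements.lift {G : SimpleGraph Q} {k : ℕ} {A : Op Q} (hA : Implements G k A) (v : Q) :
    Implements (withControl G v) k (QCircuit.extend Function.Embedding.some A) :=
  hA.extend fun _ _ h => Or.inl (SimpleGraph.map_adj_apply' h (by simpa using h.ne))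

theorem Implements.controlled_layer {G : SimpleGraph Q} {v : Q} {k : ℕ} {L : Layer Q}
    (hX : Implements (withControl G v) k (controlled (pauliX Finset.univ))) (hL : L.Under G) :
    Implements (withControl G v) (4 * k + 6) (controlled L.op) := by
  obtain ⟨z, A, hA, hop, hone⟩ := L.exists_alternate
  have hlift (i : Fin 5) := (Implements.layer (hA i G hL)).lift v
  rw [hop, controlled_circle_smul, controlled_alternate _ hone]
  refine (Implements.mul (gate (g := .one _ _) trivial) (mul (mul (mul (mul (hlift 0)
    ((hX.mul (hlift 1)).mul hX)) (hlift 2)) ((hX.mul (hlift 3)).mul hX)) (hlift 4))).mono ?_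
  omega

end Controlled

section Cnot

variable {Q : Type*} [DecidableEq Q]

/-- The controlled negation of two bits. -/
def cnotPerm : Equiv.Perm (Bool × Bool) :=
  Function.Involutive.toPerm (fun t => (t.1, t.1 ^^ t.2)) fun t => by simp

theorem cnotPerm_apply (s t : Bool) : cnotPerm (s, t) = (s, s ^^ t) :=
  rfl

/-- The negation of the bit `q`, controlled by the bit `p`. -/
def cnotOn {p q : Q} (hpq : p ≠ q) : Equiv.Perm (Basis Q) :=
  Function.Involutive.toPerm (fun x => Function.update x q (x p ^^ x q)) fun x => by simp [hpq]

theorem cnotOn_apply {p q : Q} (hpq : p ≠ q) (x : Basis Q) :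
    cnotOn hpq x = Function.update x q (x p ^^ x q) :=
  rfl

theorem cnotOn_mul_flipOn {p q : Q} (hpq : p ≠ q) {S : Finset Q} (hp : p ∈ S) (hq : q ∉ S) :
    cnotOn hpq * flipOn S = flipOn (insert q S) * cnotOn hpq := by
  ext x r
  simp only [Equiv.Perm.mul_apply, cnotOn_apply, flipOn_apply, Finset.mem_insert]
  rcases eq_or_ne r q with rfl | hr
  · simp [hp, hq]
  · simp [flipOn_apply, hr]

/-- The CNOT gate with control `p` and target `q`. -/
def Gate.cnot {p q : Q} (hpq : p ≠ q) : Gate Q :=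
  .two p q hpq (permUnitary cnotPerm)

variable [Fintype Q]

theorem Gate.two_permUnitary_op {p q : Q} (hpq : p ≠ q) {φ : Equiv.Perm (Bool × Bool)}
    {Φ : Equiv.Perm (Basis Q)} (hφ : ∀ x, (Φ x p, Φ x q) = φ (x p, x q))
    (hΦ : ∀ x r, r ≠ p → r ≠ q → Φ x r = x r) :
    (Gate.two p q hpq (permUnitary φ)).op = permUnitary Φ := by
  ext x y
  have hxy : x = Φ y ↔ (∀ r, r ≠ p → r ≠ q → x r = y r) ∧ (x p, x q) = φ (y p, y q) := by
    rw [← hφ, Prod.mk_inj]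
    refine ⟨by rintro rfl; exact ⟨hΦ y, rfl, rfl⟩, fun ⟨h, hp, hq⟩ => funext fun r => ?_⟩
    by_cases hrp : r = p
    · rw [hrp, hp]
    by_cases hrq : r = q
    · rw [hrq, hq]
    rw [h r hrp hrq, hΦ y r hrp hrq]
  simp only [Gate.op, applyTwo, permUnitary_apply, hxy, ite_and]

theorem Gate.cnot_op {p q : Q} (hpq : p ≠ q) : (Gate.cnot hpq).op = permUnitary (cnotOn hpq) :=
  Gate.two_permUnitary_op hpq (fun x => by simp [cnotOn_apply, hpq, cnotPerm_apply])
    fun x r _ hr => Function.update_of_ne hr _ _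

theorem Gate.cnot_conj_pauliX {p q : Q} (hpq : p ≠ q) {S : Finset Q} (hp : p ∈ S) (hq : q ∉ S) :
    (Gate.cnot hpq).op * pauliX S * star (Gate.cnot hpq).op = pauliX (insert q S) := by
  have h : (Gate.cnot hpq).op * pauliX S = pauliX (insert q S) * (Gate.cnot hpq).op := by
    rw [Gate.cnot_op, pauliX, pauliX, ← Submonoid.coe_mul, ← Submonoid.coe_mul, ← map_mul,
      ← map_mul, cnotOn_mul_flipOn hpq hp hq]
  rw [h, mul_assoc, Unitary.mul_star_self_of_mem (Gate.op_mem_unitaryGroup _), mul_one]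

theorem controlled_pauliX_singleton (v : Q) :
    controlled (pauliX {v}) = (Gate.cnot (Option.some_ne_none v).symm).op := by
  ext x y
  have hflip : (fun q => x (some q)) = flipOn {v} (fun q => y (some q)) ↔
      ∀ q, x (some q) = (y (some q) ^^ decide (q = v)) := by
    simp only [funext_iff, flipOn_apply, Finset.mem_singleton]
  have hcnot : x = cnotOn (Option.some_ne_none v).symm y ↔
      x none = y none ∧ ∀ q, x (some q) = (y (some q) ^^ (y none && decide (q = v))) := by
    simp only [cnotOn_apply, funext_iff, Option.forall, Function.update_apply]
    refine and_congr (by simp) (forall_congr' fun q => ?_)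
    by_cases hq : q = v <;> simp [hq, Bool.xor_comm]
  rw [Gate.cnot_op, permUnitary_apply]
  simp only [controlled, pauliX, permUnitary_apply, hflip, hcnot]
  cases hx : x none <;> cases hy : y none <;> simp [funext_iff]

end Cnot

section Broadcast

variable {Q : Type*} [Fintype Q] [DecidableEq Q] {G : SimpleGraph Q}

/-- A circuit of depth at most `k` that is constrained to `G` conjugates the Pauli operator `X` on
the qubits in `S` to `X` on the qubits in `T`. -/
def Spreads (G : SimpleGraph Q) (k : ℕ) (S T : Finset Q) : Prop :=
  ∃ A, Implements G k A ∧ A * pauliX S * star A = pauliX T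

theorem Spreads.refl (S : Finset Q) : Spreads G 0 S S :=
  ⟨1, Implements.one G 0, by simp⟩

theorem Spreads.trans {k l : ℕ} {S T U : Finset Q} (hST : Spreads G k S T)
    (hTU : Spreads G l T U) : Spreads G (k + l) S U := by
  obtain ⟨A, hA, hAop⟩ := hST
  obtain ⟨B, hB, hBop⟩ := hTU
  refine ⟨B * A, (hB.mul hA).mono (add_comm l k).le, ?_⟩
  rw [← hBop, ← hAop, star_mul]
  simp only [mul_assoc]

theorem list_prod_cnot_conj_pauliX {S T : Finset Q} (hST : Disjoint S T) {π : Q → Q}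
    (hπ : ∀ q ∈ T, π q ∈ S) (hne : ∀ q ∈ T, π q ≠ q) {l : List T} (hl : l.Nodup) :
    (l.map fun q : T => (Gate.cnot (hne q q.2)).op).prod * pauliX S *
        star (l.map fun q : T => (Gate.cnot (hne q q.2)).op).prod =
      pauliX (S ∪ (l.map Subtype.val).toFinset) := by
  induction l with
  | nil => simp
  | cons q l ih =>
    rw [List.nodup_cons] at hl
    have hq : (q : Q) ∉ S ∪ (l.map Subtype.val).toFinset := by
      simp [hl.1, Finset.disjoint_right.1 hST q.2]
    rw [List.map_cons, List.prod_cons, List.map_cons, List.toFinset_cons, Finset.union_insert,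
      ← Gate.cnot_conj_pauliX (hne q q.2) (Finset.mem_union_left _ (hπ q q.2)) hq, ← ih hl.2,
      star_mul]
    simp only [mul_assoc]

theorem Spreads.of_parent {S T : Finset Q} (hST : Disjoint S T) {π : Q → Q}
    (hπ : ∀ q ∈ T, π q ∈ S) (hadj : ∀ q ∈ T, G.Adj (π q) q) (hinj : Set.InjOn π T) :
    Spreads G 1 S (S ∪ T) := by
  have hne (q : Q) (hq : q ∈ T) : π q ≠ q := (hadj q hq).ne
  let L : Layer Q :=
    { gates := T.attach.toList.map fun q : T => Gate.cnot (hne q q.2)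
      disjoint := by
        refine List.pairwise_map.2 ((Finset.nodup_toList _).imp fun {q r} hqr => ?_)
        have hqr' : (r : Q) ≠ q := Subtype.coe_ne_coe.2 hqr.symm
        have hπqr : π r ≠ π q := hinj.ne r.2 q.2 hqr'
        have hST' {s t : Q} (hs : s ∈ S) (ht : t ∈ T) : s ≠ t := fun h =>
          Finset.disjoint_left.1 hST hs (h ▸ ht)
        simp [Gate.cnot, Gate.support, hqr.symm, hπqr, hST' (hπ r r.2) q.2,
          (hST' (hπ q q.2) r.2).symm] }
  refine ⟨L.op, Implements.layer (List.forall_mem_map.2 fun (q : T) _ => hadj q q.2), ?_⟩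
  have h := list_prod_cnot_conj_pauliX hST hπ hne (Finset.nodup_toList T.attach)
  rw [Layer.op, List.map_map]
  refine h.trans (congrArg (fun U => pauliX (S ∪ U)) ?_)
  ext q
  simp

/-- Every vertex has a height, at most `k`, and every vertex but `v` has a lower neighbour as its
parent, such that vertices of the same height have different parents. Information can then be sent
from `v` to all other vertices in `k` rounds, each of which uses disjoint edges. -/
def IsBroadcastable {V : Type*} (G : SimpleGraph V) (v : V) (k : ℕ) : Prop :=
  ∃ (h : V → ℕ) (π : V → V), (∀ q, h q ≤ k) ∧ (∀ q, h q = 0 ↔ q = v) ∧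
    (∀ q, q ≠ v → G.Adj (π q) q ∧ h (π q) < h q) ∧
    ∀ q r, q ≠ v → r ≠ v → h q = h r → π q = π r → q = r

theorem IsBroadcastable.spreads {v : Q} {k : ℕ} (hv : IsBroadcastable G v k) :
    Spreads G k {v} Finset.univ := by
  obtain ⟨h, π, hk, hzero, hπ, hinj⟩ := hv
  have hspreads (t : ℕ) : Spreads G t {v} (Finset.univ.filter (h · ≤ t)) := by
    induction t with
    | zero =>
      convert Spreads.refl (G := G) {v}
      ext q
      simp [hzero]
    | succ t ih =>
      have hlevel {q : Q} : q ∈ Finset.univ.filter (h · = t + 1) ↔ h q = t + 1 := by simp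
      have hne {q : Q} (hq : h q = t + 1) : q ≠ v := fun hqv => by
        rw [(hzero q).2 hqv] at hq
        omega
      have hunion : Finset.univ.filter (h · ≤ t + 1) =
          Finset.univ.filter (h · ≤ t) ∪ Finset.univ.filter (h · = t + 1) := by
        ext q
        simp [Nat.le_succ_iff]
      rw [hunion]
      refine ih.trans (Spreads.of_parent (π := π) ?_ (fun q hq => ?_) (fun q hq => ?_) ?_)
      · exact Finset.disjoint_filter.2 fun q _ => by omega
      · have := (hπ q (hne (hlevel.1 hq))).2
        rw [hlevel.1 hq] at this
        simpa using Nat.le_of_lt_succ this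
      · exact (hπ q (hne (hlevel.1 hq))).1
      · intro q hq r hr
        have hq := hlevel.1 hq
        have hr := hlevel.1 hr
        exact hinj q r (hne hq) (hne hr) (hq.trans hr.symm)
  convert hspreads k
  ext q
  simp [hk]

theorem IsBroadcastable.boxProd {V W : Type*} {G : SimpleGraph V} {H : SimpleGraph W} {v : V}
    {w : W} {k l : ℕ} (hv : IsBroadcastable G v k) (hw : IsBroadcastable H w l) :
    IsBroadcastable (G □ H) (v, w) (k + l) := by
  classical
  obtain ⟨h, π, hk, hzero, hπ, hinj⟩ := hv
  obtain ⟨h', π', hk', hzero', hπ', hinj'⟩ := hw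
  have hpos {b : W} (hb : b ≠ w) : 0 < h' b := Nat.pos_of_ne_zero fun h => hb ((hzero' b).1 h)
  refine ⟨fun q => if q.2 = w then h q.1 else k + h' q.2,
    fun q => if q.2 = w then (π q.1, q.2) else (q.1, π' q.2), ?_, ?_, ?_, ?_⟩
  · rintro ⟨a, b⟩
    have := hk a
    have := hk' b
    dsimp only
    split_ifs <;> omega
  · rintro ⟨a, b⟩
    by_cases hb : b = w
    · simp [hb, hzero]
    · simp [hb, hzero']
  · rintro ⟨a, b⟩ hne
    by_cases hb : b = w
    · subst hb
      obtain ⟨hadj, hlt⟩ := hπ a fun ha => hne (by rw [ha])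
      simp [SimpleGraph.boxProd_adj, hadj, hlt]
    · obtain ⟨hadj, hlt⟩ := hπ' b hb
      refine ⟨by simp [SimpleGraph.boxProd_adj, hb, hadj], ?_⟩
      have := hk a
      have := hpos hb
      simp only [hb, if_false]
      split_ifs <;> omega
  · rintro ⟨a, b⟩ ⟨c, d⟩ hab hcd heq hpar
    have := hk a
    have := hk c
    by_cases hb : b = w <;> by_cases hd : d = w
    · subst hb hd
      simp only [if_true, Prod.mk.injEq, and_true] at heq hpar
      rw [hinj a c (by rintro rfl; exact hab rfl) (by rintro rfl; exact hcd rfl) heq hpar]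
    · have := hpos hd
      simp only [hb, hd, if_true, if_false] at heq
      omega
    · have := hpos hb
      simp only [hb, hd, if_true, if_false] at heq
      omega
    · simp only [hb, hd, if_false, Prod.mk.injEq] at heq hpar
      rw [hpar.1, hinj' b d hb hd (by omega) hpar.2]

theorem isBroadcastable_pathGraph {n : ℕ} (a : Fin n) :
    IsBroadcastable (SimpleGraph.pathGraph n) a (2 * n) := by
  refine ⟨fun i => if a < i then 2 * (i - a : ℕ) - 1 else 2 * (a - i : ℕ),
    fun i => if a < i then ⟨i - 1, by omega⟩ else if h : i < a then ⟨i + 1, by omega⟩ else i,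
    fun i => ?_, fun i => ?_, fun i _ => ?_, fun i j _ _ hij _ => ?_⟩
  · dsimp only
    split_ifs <;> omega
  · dsimp only
    split_ifs <;> omega
  · rw [SimpleGraph.pathGraph_adj]
    dsimp only
    split_ifs <;> simp only [Fin.lt_def, or_true, true_and] at * <;> omega
  · dsimp only at hij
    split_ifs at hij <;> omega

theorem IsBroadcastable.implements_controlled_pauliX {v : Q} {k : ℕ}
    (hv : IsBroadcastable G v k) :
    Implements (withControl G v) (2 * k + 1) (controlled (pauliX Finset.univ)) := by
  obtain ⟨A, hA, hop⟩ := hv.spreads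
  rw [← hop, controlled_conj hA.mem_unitaryGroup, controlled_pauliX_singleton]
  refine (((hA.lift v).mul (Implements.gate ?_)).mul (hA.star.lift v)).mono (by omega)
  exact Or.inr (by simp [SimpleGraph.edge_adj])

end Broadcast

section Routing

open scoped Pointwise

/-- The product `f (k - 1) * ⋯ * f 1 * f 0`. -/
def iterProd {M : Type*} [Monoid M] (f : ℕ → M) : ℕ → M
  | 0 => 1
  | k + 1 => f k * iterProd f k

/-- The sequence `f`, preceded by two trivial terms. -/
def delay {M : Type*} [Monoid M] (f : ℕ → M) : ℕ → M
  | 0 => 1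
  | 1 => 1
  | t + 2 => f t

section Monoid

variable {M : Type*} [Monoid M] {f g : ℕ → M}

theorem iterProd_mem_pow {S : Set M} (hf : ∀ t, f t ∈ S) (k : ℕ) : iterProd f k ∈ S ^ k := by
  induction k with
  | zero => exact Set.mem_one.2 rfl
  | succ k ih =>
    rw [pow_succ']
    exact Set.mul_mem_mul (hf k) ih

theorem commute_iterProd {a : M} {k : ℕ} (h : ∀ t < k, Commute a (f t)) :
    Commute a (iterProd f k) := by
  induction k with
  | zero => exact Commute.one_right a
  | succ k ih => exact (h k k.lt_succ_self).mul_right (ih fun t ht => h t (ht.trans k.lt_succ_self))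

theorem iterProd_mul (h : ∀ s t, t < s → Commute (g s) (f t)) (k : ℕ) :
    iterProd (f * g) k = iterProd f k * iterProd g k := by
  induction k with
  | zero => simp [iterProd]
  | succ k ih =>
    have hc : Commute (g k) (iterProd f k) := commute_iterProd fun t ht => h k t ht
    simp only [iterProd, ih, Pi.mul_apply, mul_assoc]
    rw [← mul_assoc (g k), hc.eq, mul_assoc]

theorem iterProd_delay (f : ℕ → M) (k : ℕ) : iterProd (delay f) (k + 2) = iterProd f k := by
  induction k with
  | zero => simp [iterProd, delay]
  | succ k ih => rw [add_right_comm, iterProd, ih, delay, iterProd]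

theorem iterProd_delay_mul (h : ∀ s t, t + 2 ≤ s → Commute (g s) (f t)) (k : ℕ) :
    iterProd (delay f * g) (k + 2) = iterProd f k * iterProd g (k + 2) := by
  rw [← iterProd_delay f, iterProd_mul]
  rintro s (_ | _ | t) hts
  · exact Commute.one_right _
  · exact Commute.one_right _
  · exact h s t hts.le

end Monoid

/-- The involutions that exchange disjoint pairs of adjacent vertices of `G`. -/
def swapSteps {V : Type*} (G : SimpleGraph V) : Set (Equiv.Perm V) :=
  {τ | Function.Involutive τ ∧ ∀ q, τ q = q ∨ G.Adj q (τ q)}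

section SwapSteps

variable {V : Type*} {G : SimpleGraph V}

theorem one_mem_swapSteps : 1 ∈ swapSteps G :=
  ⟨fun _ => rfl, fun _ => Or.inl rfl⟩

theorem swap_mem_swapSteps [DecidableEq V] {p q : V} (h : G.Adj p q) :
    Equiv.swap p q ∈ swapSteps G := by
  refine ⟨Equiv.swap_apply_self p q, fun r => ?_⟩
  rcases eq_or_ne r p with rfl | hp
  · simp [h]
  rcases eq_or_ne r q with rfl | hq
  · simp [h.symm]
  · exact Or.inl (Equiv.swap_apply_of_ne_of_ne hp hq)

theorem mul_mem_swapSteps {σ τ : Equiv.Perm V} (hσ : σ ∈ swapSteps G) (hτ : τ ∈ swapSteps G)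
    (h : σ.Disjoint τ) : σ * τ ∈ swapSteps G := by
  have hc : σ * τ = τ * σ := h.commute
  refine ⟨fun q => ?_, fun q => ?_⟩
  · calc (σ * τ) ((σ * τ) q) = (σ * τ) ((τ * σ) q) := by rw [hc]
      _ = q := by simp [hτ.1 _, hσ.1 _]
  · rcases h q with h | h
    · rw [hc, Equiv.Perm.mul_apply, h]
      exact hτ.2 q
    · rw [Equiv.Perm.mul_apply, h]
      exact hσ.2 q

theorem delay_mem_swapSteps {f : ℕ → Equiv.Perm V} (hf : ∀ t, f t ∈ swapSteps G) :
    ∀ t, delay f t ∈ swapSteps G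
  | 0 => one_mem_swapSteps
  | 1 => one_mem_swapSteps
  | t + 2 => hf t

end SwapSteps

section Path

variable {n : ℕ}

/-- The exchange of the vertices `t` and `t + 1` of the path on `n` vertices. -/
def pathSwap (n t : ℕ) : Equiv.Perm (Fin n) :=
  if h : t + 1 < n then Equiv.swap ⟨t, t.lt_succ_self.trans h⟩ ⟨t + 1, h⟩ else 1

theorem pathSwap_mem_swapSteps (t : ℕ) : pathSwap n t ∈ swapSteps (SimpleGraph.pathGraph n) := by
  rw [pathSwap]
  split_ifs
  · exact swap_mem_swapSteps (SimpleGraph.pathGraph_adj.2 (Or.inl rfl))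
  · exact one_mem_swapSteps

theorem pathSwap_apply_of_ne {t : ℕ} {q : Fin n} (h : (q : ℕ) ≠ t) (h' : (q : ℕ) ≠ t + 1) :
    pathSwap n t q = q := by
  rw [pathSwap]
  split_ifs
  · exact Equiv.swap_apply_of_ne_of_ne (fun hq => h (congrArg Fin.val hq))
      fun hq => h' (congrArg Fin.val hq)
  · rfl

/-- The steps that move a token from `p` to `m` on the path on `n` vertices, where step `t` moves it
from `t` to `t + 1`. -/
def bubble (n p m t : ℕ) : Equiv.Perm (Fin n) :=
  if p ≤ t ∧ t < m then pathSwap n t else 1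

theorem bubble_mem_swapSteps (p m t : ℕ) :
    bubble n p m t ∈ swapSteps (SimpleGraph.pathGraph n) := by
  rw [bubble]
  split_ifs
  · exact pathSwap_mem_swapSteps t
  · exact one_mem_swapSteps

theorem bubble_apply_of_ne {p m t : ℕ} {q : Fin n} (h : (q : ℕ) ≠ t) (h' : (q : ℕ) ≠ t + 1) :
    bubble n p m t q = q := by
  rw [bubble]
  split_ifs
  · exact pathSwap_apply_of_ne h h'
  · rfl

theorem iterProd_bubble_apply_self {m : ℕ} (hm : m < n) {p : Fin n} (hpm : (p : ℕ) ≤ m) (k : ℕ) :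
    (iterProd (bubble n p m) k p : ℕ) = max (p : ℕ) (min k m) := by
  induction k with
  | zero => simp [iterProd]
  | succ k ih =>
    rw [iterProd, Equiv.Perm.mul_apply, bubble]
    split_ifs with h
    · have hk : k + 1 < n := by omega
      have hpk : iterProd (bubble n p m) k p = ⟨k, by omega⟩ := Fin.ext (by rw [ih]; dsimp; omega)
      rw [hpk, pathSwap, dif_pos hk, Equiv.swap_apply_left]
      dsimp only
      omega
    · rw [Equiv.Perm.one_apply, ih]
      omega

theorem iterProd_bubble_apply_of_lt {p m : ℕ} {q : Fin n} (hq : m < q) (k : ℕ) :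
    iterProd (bubble n p m) k q = q := by
  induction k with
  | zero => rfl
  | succ k ih =>
    rw [iterProd, Equiv.Perm.mul_apply, ih, bubble]
    split_ifs
    · exact pathSwap_apply_of_ne (by omega) (by omega)
    · rfl

theorem exists_mul_inv_iterProd_bubble_apply_eq_self {m k : ℕ} (hm : m < n) (hmk : m ≤ k)
    {σ : Equiv.Perm (Fin n)} (hσ : ∀ q : Fin n, m < q → σ q = q) :
    ∃ p, ∀ q : Fin n, m ≤ q → (σ * (iterProd (bubble n p m) k)⁻¹) q = q := by
  set p : Fin n := σ⁻¹ ⟨m, hm⟩ with hp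
  have hσp : σ p = ⟨m, hm⟩ := by simp [hp]
  have hpm : (p : ℕ) ≤ m := by
    by_contra! h
    rw [Fin.ext_iff.1 ((hσ p h).symm.trans hσp)] at h
    exact h.false
  have hend : iterProd (bubble n p m) k p = ⟨m, hm⟩ := Fin.ext (by
    rw [iterProd_bubble_apply_self hm hpm, min_eq_right hmk, max_eq_right hpm])
  refine ⟨p, fun q hq => ?_⟩
  rw [Equiv.Perm.mul_apply]
  rcases hq.eq_or_lt with hq | hq
  · rw [show q = ⟨m, hm⟩ from Fin.ext hq.symm, Equiv.Perm.inv_eq_iff_eq.2 hend.symm, hσp]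
  · rw [Equiv.Perm.inv_eq_iff_eq.2 (iterProd_bubble_apply_of_lt hq _).symm, hσ q hq]

theorem exists_iterProd_swapSteps_eq {m : ℕ} (hm : m ≤ n) (σ : Equiv.Perm (Fin n))
    (hσ : ∀ q : Fin n, m ≤ q → σ q = q) :
    ∃ f : ℕ → Equiv.Perm (Fin n), (∀ t, f t ∈ swapSteps (SimpleGraph.pathGraph n)) ∧
      (∀ t q, f t q ≠ q → (q : ℕ) ≤ t + 1) ∧ iterProd f (2 * m) = σ := by
  induction m generalizing σ with
  | zero =>
    refine ⟨1, fun _ => one_mem_swapSteps, by simp, ?_⟩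
    ext q
    simp [iterProd, hσ q]
  | succ m ih =>
    obtain ⟨p, hp⟩ := exists_mul_inv_iterProd_bubble_apply_eq_self (k := 2 * m + 2) hm (by omega) hσ
    obtain ⟨f, hf, hfm, hfσ⟩ := ih (by omega) _ hp
    set g := bubble n p m
    have hdelay (t : ℕ) (q : Fin n) (h : delay f t q ≠ q) : (q : ℕ) < t := by
      rcases t with _ | _ | t
      · exact absurd rfl h
      · exact absurd rfl h
      · exact Nat.lt_succ_of_le (hfm t q h)
    have hdisj {s t : ℕ} (hts : t ≤ s) : (delay f t).Disjoint (g s) := fun q =>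
      or_iff_not_imp_left.2 fun h =>
        have := hdelay t q h
        bubble_apply_of_ne (by omega) (by omega)
    refine ⟨delay f * g, fun t => mul_mem_swapSteps (delay_mem_swapSteps hf t)
      (bubble_mem_swapSteps _ _ t) (hdisj le_rfl), fun t q h => ?_, ?_⟩
    · contrapose! h
      rw [Pi.mul_apply, Equiv.Perm.mul_apply, bubble_apply_of_ne (by omega) (by omega)]
      by_contra hne
      have := hdelay t q hne
      omega
    · rw [mul_add_one, iterProd_delay_mul fun s t hts => ?_, hfσ, inv_mul_cancel_right]
      exact (hdisj (t := t + 2) hts).commute.symm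

theorem mem_swapSteps_pathGraph_pow (σ : Equiv.Perm (Fin n)) :
    σ ∈ swapSteps (SimpleGraph.pathGraph n) ^ (2 * n) := by
  obtain ⟨f, hf, -, rfl⟩ := exists_iterProd_swapSteps_eq le_rfl σ fun q hq => by omega
  exact iterProd_mem_pow hf _

end Path

theorem mem_pi_pow {ι : Type*} {M : ι → Type*} [∀ i, Monoid (M i)] {S : ∀ i, Set (M i)} {k : ℕ}
    {σ : ∀ i, M i} (h : ∀ i, σ i ∈ S i ^ k) : σ ∈ Set.univ.pi S ^ k := by
  induction k generalizing σ with
  | zero => exact Set.mem_one.2 (funext fun i => Set.mem_one.1 (h i))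
  | succ k ih =>
    simp only [pow_succ, Set.mem_mul] at h
    choose a ha b hb hab using h
    rw [pow_succ]
    exact Set.mem_mul.2 ⟨a, ih ha, b, fun i _ => hb i, funext hab⟩

section Rectangle

variable {V W : Type*} {G : SimpleGraph V} {H : SimpleGraph W}

/-- The permutation of the array `V × W` that acts as `σ w` on the column `V × {w}`. -/
def columnPerm : (W → Equiv.Perm V) →* Equiv.Perm (V × W) where
  toFun := Equiv.prodCongrLeft
  map_one' := rfl
  map_mul' _ _ := rfl

/-- The permutation of the array `V × W` that acts as `σ v` on the row `{v} × W`. -/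
def rowPerm : (V → Equiv.Perm W) →* Equiv.Perm (V × W) where
  toFun := Equiv.prodCongrRight
  map_one' := rfl
  map_mul' _ _ := rfl

theorem columnPerm_mem_swapSteps_pow {k : ℕ} {σ : W → Equiv.Perm V}
    (hσ : ∀ w, σ w ∈ swapSteps G ^ k) : columnPerm σ ∈ swapSteps (G □ H) ^ k := by
  have h := Set.mem_image_of_mem columnPerm (mem_pi_pow hσ)
  rw [Set.image_pow] at h
  refine Set.pow_subset_pow_left ?_ h
  rintro _ ⟨τ, hτ, rfl⟩
  refine ⟨fun ⟨v, w⟩ => Prod.ext ((hτ w trivial).1 v) rfl, fun ⟨v, w⟩ => ?_⟩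
  exact ((hτ w trivial).2 v).imp (fun h => Prod.ext h rfl) fun h => Or.inl ⟨h, rfl⟩

theorem rowPerm_mem_swapSteps_pow {k : ℕ} {σ : V → Equiv.Perm W}
    (hσ : ∀ v, σ v ∈ swapSteps H ^ k) : rowPerm σ ∈ swapSteps (G □ H) ^ k := by
  have h := Set.mem_image_of_mem rowPerm (mem_pi_pow hσ)
  rw [Set.image_pow] at h
  refine Set.pow_subset_pow_left ?_ h
  rintro _ ⟨τ, hτ, rfl⟩
  refine ⟨fun ⟨v, w⟩ => Prod.ext rfl ((hτ v trivial).1 w), fun ⟨v, w⟩ => ?_⟩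
  exact ((hτ v trivial).2 w).imp (fun h => Prod.ext rfl h) fun h => Or.inr ⟨h, rfl⟩

theorem exists_columnPerm_eq [Finite V] {σ : Equiv.Perm (V × W)} (hσ : ∀ x, (σ x).2 = x.2) :
    ∃ τ, columnPerm τ = σ := by
  have hinj (w : W) : Function.Injective fun v => (σ (v, w)).1 := fun v v' h =>
    congrArg Prod.fst (σ.injective (Prod.ext h (by rw [hσ, hσ])))
  exact ⟨fun w => Equiv.ofBijective _ (Finite.injective_iff_bijective.1 (hinj w)),
    Equiv.ext fun x => Prod.ext rfl (hσ x).symm⟩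

theorem exists_rowPerm_eq [Finite W] {σ : Equiv.Perm (V × W)} (hσ : ∀ x, (σ x).1 = x.1) :
    ∃ τ, rowPerm τ = σ := by
  have hinj (v : V) : Function.Injective fun w => (σ (v, w)).2 := fun w w' h =>
    congrArg Prod.snd (σ.injective (Prod.ext (by rw [hσ, hσ]) h))
  exact ⟨fun v => Equiv.ofBijective _ (Finite.injective_iff_bijective.1 (hinj v)),
    Equiv.ext fun x => Prod.ext (hσ x).symm rfl⟩

end Rectangle

section EdgeColouring

open Finset

variable {ι J : Type*} [DecidableEq J]

theorem card_filter_mem_of_card_fiber {k : ℕ} {X : Finset ι} {s : ι → J}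
    (hs : ∀ j, #{x ∈ X | s x = j} = k) (A : Finset J) : #{x ∈ X | s x ∈ A} = #A * k := by
  rw [← sum_card_fiberwise_eq_card_filter, sum_const_nat fun j _ => hs j]

/-- `X` is the edge set of a bipartite multigraph in which the edge `x` joins `s x` to `t x`. -/
theorem exists_perfect_matching_of_regular [Finite J] {k : ℕ} (hk : 0 < k) {X : Finset ι}
    {s t : ι → J} (hs : ∀ j, #{x ∈ X | s x = j} = k) (ht : ∀ j, #{x ∈ X | t x = j} = k) :
    ∃ e : J → ι, (∀ j, e j ∈ X) ∧ s ∘ e = id ∧ Function.Bijective (t ∘ e) := by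
  obtain ⟨f, hf, hft⟩ := (all_card_le_biUnion_card_iff_exists_injective
    fun j => {x ∈ X | s x = j}.image t).1 fun A => by
      set T := A.biUnion fun j => {x ∈ X | s x = j}.image t
      have hle : #{x ∈ X | s x ∈ A} ≤ #{x ∈ X | t x ∈ T} := card_le_card fun x hx => by
        obtain ⟨hxX, hxA⟩ := mem_filter.1 hx
        exact mem_filter.2 ⟨hxX, mem_biUnion.2
          ⟨s x, hxA, mem_image_of_mem t (mem_filter.2 ⟨hxX, rfl⟩)⟩⟩
      rw [card_filter_mem_of_card_fiber hs, card_filter_mem_of_card_fiber ht] at hle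
      exact Nat.le_of_mul_le_mul_right hle hk
  simp only [mem_image, mem_filter] at hft
  choose e he het using hft
  exact ⟨e, fun j => (he j).1, funext fun j => (he j).2, Finite.injective_iff_bijective.1
    fun i j hij => hf (by rwa [← het i, ← het j])⟩

theorem card_fiber_sdiff_image [DecidableEq ι] [Fintype J] {k : ℕ} {X : Finset ι} {s : ι → J}
    (hs : ∀ j, #{x ∈ X | s x = j} = k + 1) {e : J → ι} (he : ∀ j, e j ∈ X)
    (hse : Function.Bijective (s ∘ e)) (j : J) : #{x ∈ X \ univ.image e | s x = j} = k := by
  obtain ⟨i, rfl⟩ := hse.2 j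
  have herase : {x ∈ X \ univ.image e | s x = (s ∘ e) i} =
      {x ∈ X | s x = (s ∘ e) i}.erase (e i) := by
    ext x
    simp only [mem_filter, mem_sdiff, mem_image, mem_univ, true_and, not_exists, mem_erase]
    refine ⟨fun ⟨⟨hx, hne⟩, hsx⟩ => ⟨fun h => hne i h.symm, hx, hsx⟩,
      fun ⟨hne, hx, hsx⟩ => ⟨⟨hx, fun i' hi' => hne ?_⟩, hsx⟩⟩
    rw [← hi', hse.1 (a₁ := i') (a₂ := i) (by rw [← hsx, ← hi']; rfl)]
  have hmem : e i ∈ {x ∈ X | s x = (s ∘ e) i} := mem_filter.2 ⟨he i, rfl⟩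
  rw [herase, card_erase_of_mem hmem, hs, Nat.add_sub_cancel]

theorem exists_edge_colouring_of_regular [Finite J] {κ : Type*} [Nonempty κ] (C : Finset κ)
    (X : Finset ι) (s t : ι → J) (hs : ∀ j, #{x ∈ X | s x = j} = #C)
    (ht : ∀ j, #{x ∈ X | t x = j} = #C) :
    ∃ c : ι → κ, (∀ x ∈ X, c x ∈ C) ∧
      ∀ x ∈ X, ∀ y ∈ X, c x = c y → s x = s y ∨ t x = t y → x = y := by
  classical
  cases nonempty_fintype J
  induction C using Finset.induction_on generalizing X with
  | empty =>
    have hX (x : ι) : x ∉ X := fun hx =>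
      filter_eq_empty_iff.1 (card_eq_zero.1 (hs (s x))) hx rfl
    exact ⟨fun _ => Classical.arbitrary κ, fun x hx => (hX x hx).elim,
      fun x hx => (hX x hx).elim⟩
  | insert a C ha ih =>
    rw [card_insert_of_notMem ha] at hs ht
    obtain ⟨e, heX, hse, hte⟩ := exists_perfect_matching_of_regular (Nat.succ_pos _) hs ht
    have hse' : Function.Bijective (s ∘ e) := hse ▸ Function.bijective_id
    obtain ⟨c, hcC, hc⟩ := ih (X \ univ.image e) (card_fiber_sdiff_image hs heX hse')
      (card_fiber_sdiff_image ht heX hte)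
    have hca {x : ι} (hx : x ∈ X) (hxe : x ∉ univ.image e) : c x ≠ a := fun h =>
      ha (h ▸ hcC x (mem_sdiff.2 ⟨hx, hxe⟩))
    refine ⟨fun x => if x ∈ univ.image e then a else c x, fun x hx => ?_, fun x hx y hy hxy h => ?_⟩
    · dsimp only
      split_ifs with hxe
      · exact mem_insert_self a C
      · exact mem_insert_of_mem (hcC x (mem_sdiff.2 ⟨hx, hxe⟩))
    · dsimp only at hxy
      split_ifs at hxy with hxe hye hye
      · obtain ⟨i, -, rfl⟩ := mem_image.1 hxe
        obtain ⟨j, -, rfl⟩ := mem_image.1 hye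
        exact congrArg e (h.elim (fun h => hse'.1 h) fun h => hte.1 h)
      · exact (hca hy hye hxy.symm).elim
      · exact (hca hx hxe hxy).elim
      · exact hc x (mem_sdiff.2 ⟨hx, hxe⟩) y (mem_sdiff.2 ⟨hy, hye⟩) hxy h

end EdgeColouring

section RectangleRouting

variable {V W : Type*} [Finite V] [Finite W]

theorem exists_eq_columnPerm_mul_rowPerm_mul_columnPerm (σ : Equiv.Perm (V × W)) :
    ∃ (γ : W → Equiv.Perm V) (β : V → Equiv.Perm W) (α : W → Equiv.Perm V),
      σ = columnPerm γ * rowPerm β * columnPerm α := by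
  classical
  cases nonempty_fintype V
  cases nonempty_fintype W
  rcases isEmpty_or_nonempty V with hV | hV
  · exact ⟨1, 1, 1, Subsingleton.elim _ _⟩
  have hfiber (w : W) : (Finset.univ.filter fun x : V × W => x.2 = w).card =
      (Finset.univ : Finset V).card :=
    Finset.card_nbij' Prod.fst (·, w) (by simp) (by simp)
      (fun x hx => Prod.ext rfl (Finset.mem_filter.1 hx).2.symm) fun v _ => rfl
  have hfiber' (w : W) : (Finset.univ.filter fun x : V × W => (σ x).2 = w).card =
      (Finset.univ : Finset V).card := by
    rw [← hfiber w]
    exact Finset.card_bijective σ σ.bijective (by simp)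
  obtain ⟨c, -, hc⟩ := exists_edge_colouring_of_regular Finset.univ Finset.univ Prod.snd
    (fun x => (σ x).2) hfiber hfiber'
  have hbij {s : V × W → W} (hs : ∀ x y, c x = c y → s x = s y → x = y) :
      Function.Bijective fun x => (c x, s x) :=
    Finite.injective_iff_bijective.1 fun x y h => hs x y (Prod.mk.inj h).1 (Prod.mk.inj h).2
  let α : Equiv.Perm (V × W) := Equiv.ofBijective _ (hbij (s := Prod.snd) fun x y h h' =>
    hc x (Finset.mem_univ x) y (Finset.mem_univ y) h (Or.inl h'))
  let β : Equiv.Perm (V × W) := Equiv.ofBijective _ (hbij (s := fun x => (σ x).2) fun x y h h' =>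
    hc x (Finset.mem_univ x) y (Finset.mem_univ y) h (Or.inr h'))
  obtain ⟨α', hα⟩ := exists_columnPerm_eq (σ := α) fun x => rfl
  obtain ⟨β', hβ⟩ := exists_rowPerm_eq (σ := β * α⁻¹) (α.surjective.forall.2 fun x => by
    simp [α, β])
  obtain ⟨γ', hγ⟩ := exists_columnPerm_eq (σ := σ * β⁻¹) (β.surjective.forall.2 fun x => by
    simp [β])
  exact ⟨γ', β', α', by rw [hα, hβ, hγ]; group⟩

theorem mem_swapSteps_boxProd_pow {G : SimpleGraph V} {H : SimpleGraph W} {k l : ℕ}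
    (hG : ∀ σ, σ ∈ swapSteps G ^ k) (hH : ∀ σ, σ ∈ swapSteps H ^ l) (σ : Equiv.Perm (V × W)) :
    σ ∈ swapSteps (G □ H) ^ (k + l + k) := by
  obtain ⟨γ, β, α, rfl⟩ := exists_eq_columnPerm_mul_rowPerm_mul_columnPerm σ
  rw [pow_add, pow_add]
  exact Set.mul_mem_mul (Set.mul_mem_mul (columnPerm_mem_swapSteps_pow fun w => hG _)
    (rowPerm_mem_swapSteps_pow fun v => hH _)) (columnPerm_mem_swapSteps_pow fun w => hG _)

end RectangleRouting

end Routing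

section PermOp

open scoped Pointwise

variable {Q : Type*}

/-- The permutation of the basis states that moves the bit `q` to `σ q`. -/
def basisPerm : Equiv.Perm Q →* Equiv.Perm (Basis Q) where
  toFun σ := Equiv.arrowCongr σ (Equiv.refl Bool)
  map_one' := rfl
  map_mul' _ _ := rfl

theorem basisPerm_apply (σ : Equiv.Perm Q) (x : Basis Q) : basisPerm σ x = x ∘ ⇑σ⁻¹ :=
  rfl

variable [DecidableEq Q]

theorem list_prod_map_swap_apply {τ : Equiv.Perm Q} (hτ : Function.Involutive τ) {l : List Q}
    (hl : l.Pairwise fun q r => q ≠ r ∧ q ≠ τ r) (x : Q) :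
    (l.map fun q => Equiv.swap q (τ q)).prod x = if x ∈ l ∨ τ x ∈ l then τ x else x := by
  induction l with
  | nil => simp
  | cons q l ih =>
    rw [List.pairwise_cons] at hl
    rw [List.map_cons, List.prod_cons, Equiv.Perm.mul_apply, ih hl.2, Equiv.swap_apply_def]
    have : q ∉ l := fun h => (hl.1 q h).1 rfl
    have : τ q ∉ l := fun h => (hl.1 _ h).2 (hτ q).symm
    have := hτ x
    have := hτ q
    grind

variable [Fintype Q]

/-- The operator that moves the qubit `q` to `σ q`. -/
def permOp : Equiv.Perm Q →* Matrix.unitaryGroup (Basis Q) ℂ :=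
  permUnitary.comp basisPerm

theorem extend_toEmbedding (σ : Equiv.Perm Q) (A : Op Q) :
    extend σ.toEmbedding A = permOp σ * A * star (permOp σ : Op Q) := by
  have hstar : star (permOp σ : Op Q) = permOp σ⁻¹ := by
    rw [map_inv]
    rfl
  rw [hstar, permOp, MonoidHom.comp_apply, MonoidHom.comp_apply, permUnitary_mul_coe,
    mul_permUnitary_coe, map_inv]
  ext x y
  simp only [extend_apply, Equiv.coe_toEmbedding, σ.surjective.range_eq,
    Set.mem_univ, not_true_eq_false, false_implies, implies_true, if_true]
  rfl

theorem Layer.op_eq_permOp_conj (σ : Equiv.Perm Q) (L : Layer Q) :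
    L.op = permOp σ⁻¹ * (L.map σ.toEmbedding).op * star (permOp σ⁻¹ : Op Q) := by
  rw [← extend_toEmbedding, Layer.map_op]
  ext x y
  simp [extend_apply, Function.comp_def]

/-- The SWAP gate. -/
def Gate.swap {p q : Q} (hpq : p ≠ q) : Gate Q :=
  .two p q hpq (permUnitary (Equiv.prodComm Bool Bool))

theorem Gate.swap_op {p q : Q} (hpq : p ≠ q) : (Gate.swap hpq).op = permOp (Equiv.swap p q) :=
  Gate.two_permUnitary_op hpq (fun x => by simp [basisPerm_apply])
    fun x r hrp hrq => by simp [basisPerm_apply, Equiv.swap_apply_of_ne_of_ne hrp hrq]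

theorem exists_layer_op_eq_permOp {G : SimpleGraph Q} {τ : Equiv.Perm Q}
    (hτ : τ ∈ swapSteps G) : ∃ L : Layer Q, L.Under G ∧ L.op = permOp τ := by
  -- Of each pair of swapped vertices, the one that comes first in an enumeration places the gate.
  let e := Fintype.equivFin Q
  let T : Finset Q := Finset.univ.filter fun q => e q < e (τ q)
  have hT {q : Q} : q ∈ T ↔ e q < e (τ q) := Finset.mem_filter_univ q
  have hadj (q : T) : G.Adj q (τ q) :=
    (hτ.2 q).resolve_left fun h => (hT.1 q.2).ne (congrArg e h).symm
  have hne {q r : T} (hqr : q ≠ r) : (q : Q) ≠ r ∧ (q : Q) ≠ τ r := by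
    refine ⟨Subtype.coe_ne_coe.2 hqr, fun h => ?_⟩
    have hq := hT.1 q.2
    rw [h, hτ.1] at hq
    exact hq.asymm (hT.1 r.2)
  let L : Layer Q :=
    { gates := T.attach.toList.map fun q => Gate.swap (hadj q).ne
      disjoint := List.pairwise_map.2 <| (Finset.nodup_toList _).imp fun {q r} hqr => by
        have hrq : (r : Q) ≠ τ q := (hne (Ne.symm hqr)).2
        simp [Gate.swap, Gate.support, (hne hqr).1.symm, (hne hqr).2.symm, hrq] }
  refine ⟨L, List.forall_mem_map.2 fun q _ => hadj q, ?_⟩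
  have hprod : ((T.attach.toList.map Subtype.val).map fun q => Equiv.swap q (τ q)).prod = τ := by
    ext x
    rw [list_prod_map_swap_apply hτ.1 (List.pairwise_map.2 ((Finset.nodup_toList _).imp hne))]
    have hfix : e x = e (τ x) → x = τ x := fun h => e.injective h
    have hτx := hτ.1 x
    simp only [List.mem_map, Finset.mem_toList, Finset.mem_attach, true_and, Subtype.exists,
      exists_prop, exists_eq_right, hT, hτx]
    grind
  rw [List.map_map] at hprod
  rw [← hprod, Layer.op, List.map_map, map_list_prod, List.map_map]
  refine Eq.trans ?_ (map_list_prod (Matrix.unitaryGroup (Basis Q) ℂ).subtype _).symm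
  rw [List.map_map]
  exact congrArg List.prod (List.map_congr_left fun q _ => Gate.swap_op _)

theorem implements_permOp {G : SimpleGraph Q} {k : ℕ} {σ : Equiv.Perm Q}
    (hσ : σ ∈ swapSteps G ^ k) : Implements G k (permOp σ : Op Q) := by
  induction k generalizing σ with
  | zero =>
    rw [pow_zero, Set.mem_one] at hσ
    rw [hσ, map_one]
    exact Implements.one G 0
  | succ k ih =>
    obtain ⟨ρ, hρ, τ, hτ, rfl⟩ := Set.mem_mul.1 (pow_succ (swapSteps G) k ▸ hσ)
    obtain ⟨L, hL, hop⟩ := exists_layer_op_eq_permOp hτ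
    rw [map_mul, Submonoid.coe_mul, ← hop]
    exact (ih hρ).mul (Implements.layer hL)

end PermOp

section Snake

/-- The sites of the lattice in boustrophedon order. -/
def snake (m n : ℕ) : Fin (m * n) ≃ Fin m × Fin n :=
  finProdFinEquiv.symm.trans (rowPerm fun i => if i.val % 2 = 0 then 1 else Fin.revPerm)

theorem snake_fst {m n : ℕ} (k : Fin (m * n)) : ((snake m n k).1 : ℕ) = k / n :=
  rfl

theorem snake_snd {m n : ℕ} (k : Fin (m * n)) :
    ((snake m n k).2 : ℕ) = if k / n % 2 = 0 then k % n else n - (k % n + 1) := by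
  change ((if k / n % 2 = 0 then (1 : Equiv.Perm (Fin n)) else Fin.revPerm) k.modNat : ℕ) = _
  split_ifs
  · rfl
  · exact Fin.val_rev _

theorem snake_adj {m n : ℕ} {j k : Fin (m * n)} (hjk : (j : ℕ) + 1 = k) :
    (lattice m n).Adj (snake m n j) (snake m n k) := by
  have hn : 0 < n := Nat.pos_of_ne_zero fun h => by simpa [h] using k.pos
  simp only [lattice, SimpleGraph.boxProd_adj, SimpleGraph.pathGraph_adj, Fin.ext_iff, snake_fst,
    snake_snd, ← hjk]
  have hdm := Nat.div_add_mod j n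
  by_cases hlast : (j + 1 : ℕ) % n = 0
  · have hdiv : (j + 1 : ℕ) / n = j / n + 1 := Nat.succ_div_of_dvd (Nat.dvd_of_mod_eq_zero hlast)
    have hdm' := Nat.div_add_mod (j + 1 : ℕ) n
    rw [hdiv, hlast, mul_add] at hdm'
    rw [hdiv, hlast]
    split_ifs <;> omega
  · have hdiv : (j + 1 : ℕ) / n = j / n :=
      Nat.succ_div_of_not_dvd fun h => hlast (Nat.mod_eq_zero_of_dvd h)
    have hdm' := Nat.div_add_mod (j + 1 : ℕ) n
    have := Nat.mod_lt (j + 1 : ℕ) hn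
    rw [hdiv] at hdm' ⊢
    split_ifs <;> omega

end Snake

section PairPlacement

variable {Q : Type*}

theorem exists_equiv_fin_of_nodup [Fintype Q] {n : ℕ} (hn : Fintype.card Q = n) {l : List Q}
    (hl : l.Nodup) :
    ∃ e : Q ≃ Fin n, ∀ p q, [p, q] <:+: l → (e p : ℕ) + 1 = e q := by
  classical
  let l' := l ++ (l.toFinsetᶜ).toList
  have hl' : l'.Nodup := by
    refine hl.append (Finset.nodup_toList _) fun q hq hq' => ?_
    simp [hq] at hq'
  have hmem (q : Q) : q ∈ l' := by simp [l', em]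
  let e := hl'.getEquivOfForallMemList l' hmem
  have hlen : l'.length = n := by rw [← hn, ← Fintype.card_congr e, Fintype.card_fin]
  refine ⟨e.symm.trans (finCongr hlen), ?_⟩
  rintro p q ⟨s, t, rfl⟩
  have hidx {i : ℕ} (hi : i < l'.length) {r : Q} (hr : l'[i] = r) : l'.idxOf r = i :=
    hr ▸ hl'.idxOf_getElem i hi
  change l'.idxOf p + 1 = l'.idxOf q
  rw [hidx (i := s.length) (by simp [l']) (by simp [l']),
    hidx (i := s.length + 1) (by simp [l']) (by simp [l'])]

/-- The two qubits of a two-qubit gate, and no qubit for a one-qubit gate. -/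
def Gate.pair : Gate Q → List Q
  | .one _ _ => []
  | .two p q _ _ => [p, q]

theorem Layer.nodup_flatMap_pair (L : Layer Q) : (L.gates.flatMap Gate.pair).Nodup := by
  have hsupport (g : Gate Q) {q : Q} (hq : q ∈ g.pair) : q ∈ g.support := by
    cases g <;> simp_all [Gate.pair, Gate.support]
  refine List.nodup_flatMap.2 ⟨fun g _ => ?_, L.disjoint.imp fun {g h} hgh q hg hh =>
    Set.disjoint_left.1 hgh (hsupport g hg) (hsupport h hh)⟩
  cases g <;> simp_all [Gate.pair]

theorem Layer.exists_perm_map_under {G : SimpleGraph Q} {n : ℕ} (e : Fin n ≃ Q)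
    (he : ∀ i j : Fin n, (i : ℕ) + 1 = j → G.Adj (e i) (e j)) (L : Layer Q) :
    ∃ σ : Equiv.Perm Q, (L.map σ.toEmbedding).Under G := by
  let _ : Fintype Q := Fintype.ofEquiv _ e
  have hn : Fintype.card Q = n := by rw [← Fintype.card_congr e, Fintype.card_fin]
  obtain ⟨f, hf⟩ := exists_equiv_fin_of_nodup hn L.nodup_flatMap_pair
  refine ⟨f.trans e, List.forall_mem_map.2 fun g hg => ?_⟩
  cases g with
  | one q u => trivial
  | two p q hpq u =>
    exact he _ _ (hf p q (List.infix_of_mem_flatten (List.mem_map_of_mem (f := Gate.pair) hg)))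

end PairPlacement

section ControlledCircuit

open scoped Pointwise

variable {Q : Type*} [Fintype Q] [DecidableEq Q]

theorem implements_controlled_layer {G : SimpleGraph Q} {v : Q} {b k n : ℕ}
    (hv : IsBroadcastable G v b) (hG : ∀ σ, σ ∈ swapSteps G ^ k) (e : Fin n ≃ Q)
    (he : ∀ i j : Fin n, (i : ℕ) + 1 = j → G.Adj (e i) (e j)) (L : Layer Q) :
    Implements (withControl G v) (8 * b + 2 * k + 10) (controlled L.op) := by
  obtain ⟨σ, hσ⟩ := L.exists_perm_map_under e he
  have hroute : Implements G k (permOp σ⁻¹ : Op Q) := implements_permOp (hG σ⁻¹)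
  rw [L.op_eq_permOp_conj σ, controlled_conj (permOp σ⁻¹).2]
  exact (((hroute.lift v).mul (hv.implements_controlled_pauliX.controlled_layer hσ)).mul
    (hroute.star.lift v)).mono (by omega)

theorem implements_controlled_circuit {H : SimpleGraph (Option Q)} {k : ℕ}
    (hH : ∀ L : Layer Q, Implements H k (controlled L.op)) (C : Circuit Q) :
    Implements H (C.depth * k) (controlled C.op) := by
  induction C with
  | nil =>
    change Implements H _ (controlled 1)
    rw [controlled_one]
    exact Implements.one H _
  | cons L C ih =>
    have hop : Circuit.op (L :: C) = Circuit.op C * L.op := by simp [Circuit.op]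
    rw [hop, controlled_mul]
    exact (ih.mul (hH L)).mono (Nat.succ_mul _ _).ge

theorem implements_controlled_circuit_lattice {l₁ l₂ : ℕ} (v : Fin l₁ × Fin l₂)
    (C : Circuit (Fin l₁ × Fin l₂)) :
    Implements (withControl (lattice l₁ l₂) v) (34 * (C.depth * (l₁ + l₂))) (controlled C.op) := by
  have hv : IsBroadcastable (lattice l₁ l₂) v (2 * l₁ + 2 * l₂) :=
    (isBroadcastable_pathGraph v.1).boxProd (isBroadcastable_pathGraph v.2)
  have hroute : ∀ σ, σ ∈ swapSteps (lattice l₁ l₂) ^ (2 * l₁ + 2 * l₂ + 2 * l₁) :=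
    mem_swapSteps_boxProd_pow mem_swapSteps_pathGraph_pow mem_swapSteps_pathGraph_pow
  have hlayer (L : Layer (Fin l₁ × Fin l₂)) :
      Implements (withControl (lattice l₁ l₂) v) (34 * (l₁ + l₂)) (controlled L.op) := by
    refine (implements_controlled_layer hv hroute (snake l₁ l₂) (fun _ _ => snake_adj) L).mono ?_
    have := v.1.pos
    omega
  exact (implements_controlled_circuit hlayer C).mono (Nat.mul_left_comm _ _ _).le

end ControlledCircuit

section HadamardTest

theorem inv_sqrt_two_mul_self : ((√2 : ℝ) : ℂ)⁻¹ * ((√2 : ℝ) : ℂ)⁻¹ = 1 / 2 := by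
  rw [← mul_inv, ← Complex.ofReal_mul, Real.mul_self_sqrt zero_le_two, Complex.ofReal_ofNat,
    one_div]

theorem gateH_mem_unitaryGroup : gateH ∈ Matrix.unitaryGroup Bool ℂ := by
  rw [Matrix.mem_unitaryGroup_iff]
  ext a b
  rw [Matrix.mul_apply, Fintype.sum_bool]
  cases a <;> cases b <;>
    simp only [gateH, Matrix.star_apply, Matrix.one_apply, star_neg, star_inv₀, mul_neg, neg_mul,
      Complex.star_def, Complex.conj_ofReal, neg_add_cancel, Bool.false_eq_true,
      Bool.true_eq_false, and_true, and_false, if_true, if_false] <;>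
    linear_combination (2 : ℂ) * inv_sqrt_two_mul_self

theorem gateS_mem_unitaryGroup : gateS ∈ Matrix.unitaryGroup Bool ℂ := by
  rw [Matrix.mem_unitaryGroup_iff, gateS, Matrix.star_eq_conjTranspose,
    Matrix.diagonal_conjTranspose, Matrix.diagonal_mul_diagonal, ← Matrix.diagonal_one]
  congr 1
  funext a
  cases a <;> simp

theorem gateS_pow (j : ℕ) :
    gateS ^ j = Matrix.diagonal fun a => if a = true then Complex.I ^ j else 1 := by
  rw [gateS, Matrix.diagonal_pow]
  congr 1
  funext a
  cases a <;> simp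

theorem sum_norm_sq_one_add_apply {ι : Type*} [Fintype ι] [DecidableEq ι] {A : Matrix ι ι ℂ}
    (hA : A ∈ Matrix.unitaryGroup ι ℂ) (i : ι) :
    ∑ j, ‖(1 + A) j i‖ ^ 2 = 2 + 2 * (A i i).re := by
  have hsq : star (1 + A) * (1 + A) = 1 + 1 + (A + star A) := by
    rw [star_add, star_one, mul_add, add_mul, add_mul, Unitary.star_mul_self_of_mem hA]
    noncomm_ring
  have hentry := congrArg Complex.re (congrFun (congrFun hsq i) i)
  simp only [Matrix.mul_apply (M := star _), Matrix.star_apply (1 + A), Complex.star_def,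
    Complex.conj_mul', Complex.re_sum, ← Complex.ofReal_pow, Complex.ofReal_re] at hentry
  rw [hentry]
  simp only [Matrix.add_apply, Matrix.one_apply_eq, Matrix.star_apply, Complex.star_def,
    Complex.add_re, Complex.one_re, Complex.conj_re]
  ring

variable {Q : Type*}

/-- The basis state with control bit `b` and remaining bits `w`. -/
def withBit (b : Bool) (w : Basis Q) : Basis (Option Q) :=
  Equiv.piOptionEquivProd.symm (b, w)

theorem withBit_none (b : Bool) (w : Basis Q) : withBit b w none = b :=
  rfl

theorem withBit_some (b : Bool) (w : Basis Q) (q : Q) : withBit b w (some q) = w q :=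
  rfl

theorem zeroState_option :
    zeroState (Option Q) = withBit false (zeroState Q) := by
  funext q
  cases q <;> rfl

variable [Fintype Q]

theorem controlled_withBit (U : Op Q) (b c : Bool) (w w' : Basis Q) :
    controlled U (withBit b w) (withBit c w') =
      if b = c then (if b then U else 1) w w' else 0 := by
  rw [controlled_eq_block]
  rfl

variable [DecidableEq Q]

theorem Implements.hadamardTest {G : SimpleGraph (Option Q)} {k : ℕ} {U : Op Q}
    (h : Implements G k (controlled U)) (j : ℕ) :
    Implements G (k + 3) (QCircuit.hadamardTest U j) := by
  have hH : Implements G 1 (applyOne none gateH) :=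
    Implements.gate (g := .one none ⟨gateH, gateH_mem_unitaryGroup⟩) trivial
  have hS : Implements G 1 (applyOne none (gateS ^ j)) :=
    Implements.gate (g := .one none ⟨gateS ^ j, pow_mem gateS_mem_unitaryGroup j⟩) trivial
  exact (((hH.mul hS).mul h).mul hH).mono (by omega)

theorem sum_withBit {M : Type*} [AddCommMonoid M] (f : Basis (Option Q) → M) :
    ∑ x, f x = ∑ b : Bool, ∑ w : Basis Q, f (withBit b w) := by
  rw [← (Equiv.piOptionEquivProd (α := Q) (β := fun _ => Bool)).symm.sum_comp,
    Fintype.sum_prod_type]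
  rfl

theorem applyOne_none_withBit (u : Matrix Bool Bool ℂ) (b c : Bool) (w w' : Basis Q) :
    applyOne none u (withBit b w) (withBit c w') = if w = w' then u b c else 0 := by
  simp only [applyOne, Option.forall, withBit_none, withBit_some, funext_iff]
  simp

theorem hadamardTest_withBit_false (U : Op Q) (j : ℕ) (w w' : Basis Q) :
    hadamardTest U j (withBit false w) (withBit false w') =
      (1 + Complex.I ^ j • U) w w' / 2 := by
  rw [hadamardTest, mul_assoc, mul_assoc]
  simp only [Matrix.mul_apply, sum_withBit, applyOne_none_withBit, controlled_withBit, ite_mul,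
    zero_mul, mul_ite, mul_zero, Finset.sum_ite_eq, Finset.sum_ite_eq', Finset.mem_univ, if_true,
    Fintype.sum_bool, gateS_pow, gateH, Matrix.diagonal_apply, Matrix.add_apply, Matrix.smul_apply,
    smul_eq_mul, Bool.false_eq_true, Bool.true_eq_false, and_true, and_false, if_false, add_zero,
    zero_add, one_mul]
  linear_combination ((1 : Op Q) w w' + Complex.I ^ j * U w w') * inv_sqrt_two_mul_self

theorem probZero_hadamardTest {U : Op Q} (hU : U ∈ Matrix.unitaryGroup (Basis Q) ℂ) (j : ℕ) :
    probZero (hadamardTest U j) =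
      (1 + (Complex.I ^ j * U (zeroState Q) (zeroState Q)).re) / 2 := by
  have hV : Complex.I ^ j • U ∈ Matrix.unitaryGroup (Basis Q) ℂ := by
    rw [Matrix.mem_unitaryGroup_iff, star_smul, smul_mul_smul_comm, Unitary.mul_star_self_of_mem hU]
    simp [← mul_pow]
  simp only [probZero, sum_withBit, Fintype.sum_bool, withBit_none, Bool.true_eq_false, if_false,
    Finset.sum_const_zero, zero_add, if_true, zeroState_option, hadamardTest_withBit_false,
    norm_div, div_pow, ← Finset.sum_div, sum_norm_sq_one_add_apply hV, Matrix.smul_apply,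
    smul_eq_mul]
  norm_num
  ring

end HadamardTest

end QCircuit

theorem mainTheorem6 :
    ∃ K : ℕ, ∀ (l₁ l₂ d : ℕ) (v : Fin l₁ × Fin l₂) (C : QCircuit.Circuit (Fin l₁ × Fin l₂)),
      C.depth = d →
      (∃ W : QCircuit.Circuit (Option (Fin l₁ × Fin l₂)),
        W.Under (QCircuit.withControl (QCircuit.lattice l₁ l₂) v) ∧
        W.depth ≤ K * (d * (l₁ + l₂)) ∧
        W.op = QCircuit.controlled C.op) ∧
      (1 ≤ d →
        (∃ W₀ : QCircuit.Circuit (Option (Fin l₁ × Fin l₂)),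
          W₀.Under (QCircuit.withControl (QCircuit.lattice l₁ l₂) v) ∧
          W₀.depth ≤ K * (d * (l₁ + l₂)) ∧
          W₀.op = QCircuit.hadamardTest C.op 0 ∧
          QCircuit.probZero W₀.op =
            (1 + (C.op (QCircuit.zeroState _) (QCircuit.zeroState _)).re) / 2) ∧
        (∃ W₁ : QCircuit.Circuit (Option (Fin l₁ × Fin l₂)),
          W₁.Under (QCircuit.withControl (QCircuit.lattice l₁ l₂) v) ∧
          W₁.depth ≤ K * (d * (l₁ + l₂)) ∧
          W₁.op = QCircuit.hadamardTest C.op 1 ∧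
          QCircuit.probZero W₁.op =
            (1 - (C.op (QCircuit.zeroState _) (QCircuit.zeroState _)).im) / 2)) := by
  refine ⟨37, ?_⟩
  rintro l₁ l₂ d v C rfl
  have hC := QCircuit.implements_controlled_circuit_lattice v C
  refine ⟨hC.mono (by omega), fun hd => ?_⟩
  have htest (j : ℕ) : ∃ W : QCircuit.Circuit (Option (Fin l₁ × Fin l₂)),
      W.Under (QCircuit.withControl (QCircuit.lattice l₁ l₂) v) ∧
      W.depth ≤ 37 * (C.depth * (l₁ + l₂)) ∧ W.op = QCircuit.hadamardTest C.op j ∧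
      QCircuit.probZero W.op =
        (1 + (Complex.I ^ j * C.op (QCircuit.zeroState _) (QCircuit.zeroState _)).re) / 2 := by
    have hpos : 1 ≤ C.depth * (l₁ + l₂) := Nat.mul_pos hd (Nat.add_pos_left v.1.pos _)
    obtain ⟨W, hG, hdepth, hop⟩ := (hC.hadamardTest j).mono
      (show _ ≤ 37 * (C.depth * (l₁ + l₂)) by omega)
    exact ⟨W, hG, hdepth, hop, hop ▸ QCircuit.probZero_hadamardTest C.op_mem_unitaryGroup j⟩
  constructor
  · simpa only [pow_zero, one_mul] using htest 0
  · simpa only [pow_one, Complex.I_mul_re, ← sub_eq_add_neg] using htest 1
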